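/- Let $H$ be a finite-dimensional Hopf algebra over $\mathbb{C}$ (for instance a finite-dimensional $C^*$ Hopf algebra), with comultiplication $\Delta$ and counit $\varepsilon$. All modules, bimodules and algebras below are finite-dimensional over $\mathbb{C}$. Let $\mathsf{Rep}(H)$ be the monoidal category of left $H$-modules. A left $H$-comodule algebra is an algebra $\mathfrak{A}$ with a left $H$-coaction $\beta_{\mathfrak{A}}:\mathfrak{A}\to H\otimes\mathfrak{A}$, $a\mapsto\sum a^{[-1]}\otimes a^{[0]}$, that is an algebra homomorphism. The category ${}_{\mathfrak{A}}\mathsf{Mod}$ of left $\mathfrak{A}$-modules is then a $\mathsf{Rep}(H)$-module category, with $X\otimes M$ the tensor product over $\mathbb{C}$ and $a\cdot(x\otimes m)=\sum a^{[-1]}x\otimes a^{[0]}m$. For left $H$-comodule algebras $\mathfrak{A}$ and $\mathfrak{B}$, let $\mathsf{Fun}_{\mathsf{Rep}(H)}({}_{\mathfrak{A}}\mathsf{Mod},{}_{\mathfrak{B}}\mathsf{Mod})$ be the category of $\mathsf{Rep}(H)$-module functors: $\mathbb{C}$-linear functors $F$ with natural isomorphisms $F(X\otimes M)\cong X\otimes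 F(M)$ satisfying the usual associativity and unit axioms; its morphisms are the natural transformations compatible with these isomorphisms. Let $\mathsf{Fun}^{\mathrm{rex}}_{\mathsf{Rep}(H)}({}_{\mathfrak{A}}\mathsf{Mod},{}_{\mathfrak{B}}\mathsf{Mod})$ be its full subcategory of right exact functors. Let ${}^H_{\mathfrak{B}}\mathsf{Mod}_{\mathfrak{A}}$ be the category of left $H$-covariant $\mathfrak{B}|\mathfrak{A}$-bimodules: $\mathfrak{B}|\mathfrak{A}$-bimodules $Y$ with a left $H$-coaction $y\mapsto\sum y^{[-1]}\otimes y^{[0]}$ such that $$\sum (b y a)^{[-1]}\otimes (b y a)^{[0]}=\sum b^{[-1]}y^{[-1]}a^{[-1]}\otimes b^{[0]}y^{[0]}a^{[0]}\qquad(b\in\mathfrak{B},\ a\in\mathfrak{A});$$ its morphisms are the bimodule maps that are also comodule maps. 1. (Excitations of the $\mathfrak{A}$-boundary.) For every left $H$-comodule algebra $\mathfrak{A}$, the assignment $Y\mapsto Y\otimes_{\mathfrak{A}}-$, with the module functor structure $y\otimes(x\otimes m)\mapsto\sum y^{[-1]}x\otimes(y^{[0]}\otimes m)$, is an equivalence of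 categories $${}^H_{\mathfrak{A}}\mathsf{Mod}_{\mathfrak{A}}\simeq\mathsf{Fun}^{\mathrm{rex}}_{\mathsf{Rep}(H)}({}_{\mathfrak{A}}\mathsf{Mod},{}_{\mathfrak{A}}\mathsf{Mod}).$$ If $\mathfrak{A}$ is semisimple, it is an equivalence onto the category $\mathsf{Fun}_{\mathsf{Rep}(H)}({}_{\mathfrak{A}}\mathsf{Mod},{}_{\mathfrak{A}}\mathsf{Mod})$ of all module functors. 2. (Defects from the $\mathfrak{A}$-boundary to the $\mathfrak{B}$-boundary.) For all left $H$-comodule algebras $\mathfrak{A}$ and $\mathfrak{B}$, the same assignment is an equivalence of categories $${}^H_{\mathfrak{B}}\mathsf{Mod}_{\mathfrak{A}}\simeq\mathsf{Fun}^{\mathrm{rex}}_{\mathsf{Rep}(H)}({}_{\mathfrak{A}}\mathsf{Mod},{}_{\mathfrak{B}}\mathsf{Mod}),$$ and if $\mathfrak{A}$ is semisimple, it is an equivalence onto the category $\mathsf{Fun}_{\mathsf{Rep}(H)}({}_{\mathfrak{A}}\mathsf{Mod},{}_{\mathfrak{B}}\mathsf{Mod})$ of all module functors. -/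

import Mathlib

open CategoryTheory MonoidalCategory TensorProduct

universe u

noncomputable section

namespace HopfBoundary

/-- If `R` acts on `V` and `S` acts on `W`, then `R ⊗ S` acts on `V ⊗ W` by
`(r ⊗ s) (v ⊗ w) = r v ⊗ s w`. -/
def extTensor {R S V W : Type*} [Ring R] [Algebra ℂ R] [Ring S] [Algebra ℂ S]
    [AddCommGroup V] [Module ℂ V] [AddCommGroup W] [Module ℂ W]
    (ρ : R →ₐ[ℂ] Module.End ℂ V) (σ : S →ₐ[ℂ] Module.End ℂ W) :
    R ⊗[ℂ] S →ₐ[ℂ] Module.End ℂ (V ⊗[ℂ] W) :=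
  (Module.endTensorEndAlgHom (R := ℂ) (S := ℂ) (A := ℂ)).comp (Algebra.TensorProduct.map ρ σ)

@[simp]
theorem extTensor_tmul {R S V W : Type*} [Ring R] [Algebra ℂ R] [Ring S] [Algebra ℂ S]
    [AddCommGroup V] [Module ℂ V] [AddCommGroup W] [Module ℂ W]
    (ρ : R →ₐ[ℂ] Module.End ℂ V) (σ : S →ₐ[ℂ] Module.End ℂ W) (r : R) (s : S) (v : V) (w : W) :
    extTensor ρ σ (r ⊗ₜ[ℂ] s) (v ⊗ₜ[ℂ] w) = ρ r v ⊗ₜ[ℂ] σ s w := by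
  simp [extTensor, Module.endTensorEndAlgHom_apply]

/-! ### Finite-dimensional modules over a complex algebra -/

/-- A finite-dimensional left module over a complex algebra `R`: a finite-dimensional complex
vector space with an algebra homomorphism from `R` to its endomorphisms. -/
structure FDMod (R : Type u) [Ring R] [Algebra ℂ R] where
  carrier : Type u
  [addCommGroup : AddCommGroup carrier]
  [module : Module ℂ carrier]
  [finite : FiniteDimensional ℂ carrier]
  act : R →ₐ[ℂ] Module.End ℂ carrier

attribute [instance] FDMod.addCommGroup FDMod.module FDMod.finite

namespace FDMod

instance (R : Type u) [Ring R] [Algebra ℂ R] : CoeSort (FDMod R) (Type u) := ⟨FDMod.carrier⟩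

section Category

variable {R : Type u} [Ring R] [Algebra ℂ R]

/-- Homomorphisms of `R`-modules. -/
@[ext]
structure Hom (X Y : FDMod R) where
  lin : X.carrier →ₗ[ℂ] Y.carrier
  map_act : ∀ (r : R) (x : X.carrier), lin (X.act r x) = Y.act r (lin x)

instance : Category (FDMod R) where
  Hom X Y := Hom X Y
  id X := ⟨LinearMap.id, fun _ _ => rfl⟩
  comp f g := ⟨g.lin ∘ₗ f.lin, fun r x => by simp [f.map_act, g.map_act]⟩

/-- The underlying linear map of a module homomorphism. -/
def lin {X Y : FDMod R} (f : X ⟶ Y) : X.carrier →ₗ[ℂ] Y.carrier := Hom.lin f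

/-- Homomorphisms from linear maps that commute with the actions. -/
def ofLin {X Y : FDMod R} (f : X.carrier →ₗ[ℂ] Y.carrier)
    (h : ∀ (r : R) (x : X.carrier), f (X.act r x) = Y.act r (f x)) : X ⟶ Y :=
  (⟨f, h⟩ : Hom X Y)

theorem map_act {X Y : FDMod R} (f : X ⟶ Y) (r : R) (x : X.carrier) :
    lin f (X.act r x) = Y.act r (lin f x) := Hom.map_act f r x

@[simp]
theorem lin_ofLin {X Y : FDMod R} (f : X.carrier →ₗ[ℂ] Y.carrier)
    (h : ∀ (r : R) (x : X.carrier), f (X.act r x) = Y.act r (f x)) : lin (ofLin f h) = f := rfl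

@[simp]
theorem lin_id (X : FDMod R) : lin (𝟙 X) = LinearMap.id := rfl

@[simp]
theorem lin_comp {X Y Z : FDMod R} (f : X ⟶ Y) (g : Y ⟶ Z) :
    lin (f ≫ g) = lin g ∘ₗ lin f := rfl

@[ext]
theorem hom_ext {X Y : FDMod R} {f g : X ⟶ Y} (h : lin f = lin g) : f = g := Hom.ext h

/-- A linear equivalence that commutes with the actions is an isomorphism of modules. -/
def isoOfLin {X Y : FDMod R} (e : X.carrier ≃ₗ[ℂ] Y.carrier)
    (h : ∀ (r : R) (x : X.carrier), e (X.act r x) = Y.act r (e x)) : X ≅ Y where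
  hom := ofLin e.toLinearMap h
  inv := ofLin e.symm.toLinearMap (fun r y => by
    apply e.injective
    simp [h])
  hom_inv_id := by ext x; simp
  inv_hom_id := by ext x; simp

@[simp]
theorem lin_isoOfLin_hom {X Y : FDMod R} (e : X.carrier ≃ₗ[ℂ] Y.carrier)
    (h : ∀ (r : R) (x : X.carrier), e (X.act r x) = Y.act r (e x)) :
    lin (isoOfLin e h).hom = e.toLinearMap := rfl

@[simp]
theorem lin_isoOfLin_inv {X Y : FDMod R} (e : X.carrier ≃ₗ[ℂ] Y.carrier)
    (h : ∀ (r : R) (x : X.carrier), e (X.act r x) = Y.act r (e x)) :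
    lin (isoOfLin e h).inv = e.symm.toLinearMap := rfl

section Linear

variable (X Y : FDMod R)

instance : Zero (X ⟶ Y) := ⟨ofLin 0 (by simp)⟩

instance : Add (X ⟶ Y) := ⟨fun f g => ofLin (lin f + lin g) (by simp [map_act])⟩

instance : Neg (X ⟶ Y) := ⟨fun f => ofLin (-lin f) (by simp [map_act])⟩

instance : Sub (X ⟶ Y) :=
  ⟨fun f g => ofLin (lin f - lin g) (by simp [map_act])⟩

instance : SMul ℂ (X ⟶ Y) := ⟨fun c f => ofLin (c • lin f) (by simp [map_act])⟩

instance : SMul ℕ (X ⟶ Y) := ⟨fun n f => ofLin (n • lin f) (by simp [map_act])⟩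

instance : SMul ℤ (X ⟶ Y) := ⟨fun n f => ofLin (n • lin f) (by simp [map_act])⟩

theorem lin_injective : Function.Injective (fun f : X ⟶ Y => lin f) := fun _ _ h => hom_ext h

instance : AddCommGroup (X ⟶ Y) :=
  Function.Injective.addCommGroup (fun f : X ⟶ Y => lin f) (lin_injective X Y) rfl
    (fun _ _ => rfl) (fun _ => rfl) (fun _ _ => rfl) (fun _ _ => rfl) (fun _ _ => rfl)

/-- Taking the underlying linear map is additive. -/
def linAddHom : (X ⟶ Y) →+ (X.carrier →ₗ[ℂ] Y.carrier) where
  toFun f := lin f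
  map_zero' := rfl
  map_add' _ _ := rfl

instance : Module ℂ (X ⟶ Y) :=
  Function.Injective.module ℂ (linAddHom X Y) (lin_injective X Y) (fun _ _ => rfl)

end Linear

@[simp]
theorem lin_add {X Y : FDMod R} (f g : X ⟶ Y) : lin (f + g) = lin f + lin g := rfl

@[simp]
theorem lin_smul {X Y : FDMod R} (c : ℂ) (f : X ⟶ Y) : lin (c • f) = c • lin f := rfl

instance : Preadditive (FDMod R) where
  homGroup X Y := inferInstance
  add_comp := by intros; ext x; simp
  comp_add := by intros; ext x; simp

instance : Linear ℂ (FDMod R) where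
  homModule X Y := inferInstance
  smul_comp := by intros; ext x; simp
  comp_smul := by intros; ext x; simp

end Category

end FDMod

/-! ### Comodule algebras -/

/-- A left comodule algebra over a bialgebra `H`: an algebra `A` with a left `H`-coaction
`A → H ⊗ A` that is a homomorphism of algebras. -/
class LeftComoduleAlgebra (H A : Type u) [Ring H] [Bialgebra ℂ H] [Ring A] [Algebra ℂ A] where
  coact : A →ₐ[ℂ] H ⊗[ℂ] A
  coassoc : ∀ a : A,
    TensorProduct.assoc ℂ H H A
        (LinearMap.rTensor A (Coalgebra.comul : H →ₗ[ℂ] H ⊗[ℂ] H) (coact a)) =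
      LinearMap.lTensor H coact.toLinearMap (coact a)
  counit : ∀ a : A,
    TensorProduct.lid ℂ A
        (LinearMap.rTensor A (Coalgebra.counit : H →ₗ[ℂ] ℂ) (coact a)) = a

/-- `H` is a left comodule algebra over itself through its comultiplication. -/
instance (H : Type u) [Ring H] [Bialgebra ℂ H] : LeftComoduleAlgebra H H where
  coact := Bialgebra.comulAlgHom ℂ H
  coassoc a := by simp
  counit a := by
    simp [Coalgebra.rTensor_counit_comul]

namespace FDMod

section Action

variable {H A : Type u} [Ring H] [Bialgebra ℂ H] [Ring A] [Algebra ℂ A]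

theorem map_extTensor {X X' : FDMod H} {M M' : FDMod A} (f : X ⟶ X') (g : M ⟶ M')
    (t : H ⊗[ℂ] A) (z : X.carrier ⊗[ℂ] M.carrier) :
    TensorProduct.map (lin f) (lin g) (extTensor X.act M.act t z) =
      extTensor X'.act M'.act t (TensorProduct.map (lin f) (lin g) z) := by
  induction t with
  | zero => simp
  | add t s ht hs => simp [ht, hs]
  | tmul h a =>
    induction z with
    | zero => simp
    | add z w hz hw => simp only [map_add, hz, hw]
    | tmul x m => simp [map_act]

theorem assoc_extTensor (X Y : FDMod H) (M : FDMod A) (t : (H ⊗[ℂ] H) ⊗[ℂ] A)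
    (z : (X.carrier ⊗[ℂ] Y.carrier) ⊗[ℂ] M.carrier) :
    TensorProduct.assoc ℂ _ _ _ (extTensor (extTensor X.act Y.act) M.act t z) =
      extTensor X.act (extTensor Y.act M.act) (TensorProduct.assoc ℂ _ _ _ t)
        (TensorProduct.assoc ℂ _ _ _ z) := by
  induction t with
  | zero => simp
  | add t s ht hs => simp [ht, hs]
  | tmul t a =>
    induction t with
    | zero => simp
    | add t s ht hs => simp only [TensorProduct.add_tmul, map_add, LinearMap.add_apply, ht, hs]
    | tmul h k =>
      induction z with
      | zero => simp
      | add z w hz hw => simp only [map_add, hz, hw]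
      | tmul z m =>
        induction z with
        | zero => simp
        | add z w hz hw => simp only [TensorProduct.add_tmul, map_add, hz, hw]
        | tmul x y => simp

theorem extTensor_comp_left {R R' S V W : Type*} [Ring R] [Algebra ℂ R] [Ring R'] [Algebra ℂ R']
    [Ring S] [Algebra ℂ S] [AddCommGroup V] [Module ℂ V] [AddCommGroup W] [Module ℂ W]
    (ρ : R →ₐ[ℂ] Module.End ℂ V) (φ : R' →ₐ[ℂ] R) (σ : S →ₐ[ℂ] Module.End ℂ W)
    (t : R' ⊗[ℂ] S) :
    extTensor (ρ.comp φ) σ t = extTensor ρ σ (LinearMap.rTensor S φ.toLinearMap t) := by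
  induction t with
  | zero => simp
  | add t s ht hs => simp [ht, hs]
  | tmul r s => ext v w; simp

theorem extTensor_comp_right {R S S' V W : Type*} [Ring R] [Algebra ℂ R] [Ring S'] [Algebra ℂ S']
    [Ring S] [Algebra ℂ S] [AddCommGroup V] [Module ℂ V] [AddCommGroup W] [Module ℂ W]
    (ρ : R →ₐ[ℂ] Module.End ℂ V) (σ : S →ₐ[ℂ] Module.End ℂ W) (φ : S' →ₐ[ℂ] S)
    (t : R ⊗[ℂ] S') :
    extTensor ρ (σ.comp φ) t = extTensor ρ σ (LinearMap.lTensor R φ.toLinearMap t) := by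
  induction t with
  | zero => simp
  | add t s ht hs => simp [ht, hs]
  | tmul r s => ext v w; simp

variable (H) in
/-- The action of `H` on `ℂ` through the counit. -/
def trivAct : H →ₐ[ℂ] Module.End ℂ (ULift.{u} ℂ) :=
  (Algebra.ofId ℂ (Module.End ℂ (ULift.{u} ℂ))).comp (Bialgebra.counitAlgHom ℂ H)

theorem trivAct_apply (h : H) (c : ULift.{u} ℂ) :
    trivAct H h c = (Coalgebra.counit (R := ℂ) h) • c := by
  simp [trivAct, Algebra.ofId_apply, Module.algebraMap_end_apply]

variable (H) in
/-- The trivial one-dimensional `H`-module, on which `H` acts through its counit. -/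
def triv : FDMod H where
  carrier := ULift.{u} ℂ
  act := trivAct H

/-- `c ⊗ m ↦ c m`. -/
def trivTensor (V : Type u) [AddCommGroup V] [Module ℂ V] : ULift.{u} ℂ ⊗[ℂ] V ≃ₗ[ℂ] V :=
  (TensorProduct.congr ULift.moduleEquiv (LinearEquiv.refl ℂ V)).trans (TensorProduct.lid ℂ V)

/-- `m ⊗ c ↦ c m`. -/
def tensorTriv (V : Type u) [AddCommGroup V] [Module ℂ V] : V ⊗[ℂ] ULift.{u} ℂ ≃ₗ[ℂ] V :=
  (TensorProduct.congr (LinearEquiv.refl ℂ V) ULift.moduleEquiv).trans (TensorProduct.rid ℂ V)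

@[simp]
theorem trivTensor_tmul (V : Type u) [AddCommGroup V] [Module ℂ V] (c : ULift.{u} ℂ) (v : V) :
    trivTensor V (c ⊗ₜ[ℂ] v) = c.down • v := rfl

@[simp]
theorem tensorTriv_tmul (V : Type u) [AddCommGroup V] [Module ℂ V] (c : ULift.{u} ℂ) (v : V) :
    tensorTriv V (v ⊗ₜ[ℂ] c) = c.down • v := rfl

theorem trivTensor_extTensor (M : FDMod A) (t : H ⊗[ℂ] A) (z : ULift.{u} ℂ ⊗[ℂ] M.carrier) :
    trivTensor M.carrier (extTensor (trivAct H) M.act t z) =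
      M.act (TensorProduct.lid ℂ A (LinearMap.rTensor A Coalgebra.counit t))
        (trivTensor M.carrier z) := by
  induction t with
  | zero => simp
  | add t s ht hs => simp only [map_add, LinearMap.add_apply, ht, hs]
  | tmul h a =>
    induction z with
    | zero => simp
    | add z w hz hw => simp only [map_add, hz, hw]
    | tmul c m =>
      simp [trivAct_apply]
      rw [mul_smul]
      exact smul_comm (Coalgebra.counit (R := ℂ) h) c.down (M.act a m)

theorem tensorTriv_extTensor (M : FDMod A) (t : A ⊗[ℂ] H) (z : M.carrier ⊗[ℂ] ULift.{u} ℂ) :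
    tensorTriv M.carrier (extTensor M.act (trivAct H) t z) =
      M.act (TensorProduct.rid ℂ A (LinearMap.lTensor A Coalgebra.counit t))
        (tensorTriv M.carrier z) := by
  induction t with
  | zero => simp
  | add t s ht hs => simp only [map_add, LinearMap.add_apply, ht, hs]
  | tmul a h =>
    induction z with
    | zero => simp
    | add z w hz hw => simp only [map_add, hz, hw]
    | tmul m c =>
      simp [trivAct_apply]
      exact smul_comm (Coalgebra.counit (R := ℂ) h) c.down (M.act a m)

variable [LeftComoduleAlgebra H A]

/-- The `A`-module `X ⊗ M`, for an `H`-module `X` and an `A`-module `M`, with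
`a (x ⊗ m) = ∑ a₍₋₁₎ x ⊗ a₍₀₎ m`. -/
def tens (X : FDMod H) (M : FDMod A) : FDMod A where
  carrier := X.carrier ⊗[ℂ] M.carrier
  act := (extTensor X.act M.act).comp (LeftComoduleAlgebra.coact (H := H))

theorem tens_act (X : FDMod H) (M : FDMod A) (a : A) :
    (tens X M).act a = extTensor X.act M.act (LeftComoduleAlgebra.coact (H := H) a) := rfl

/-- `f ⊗ g : X ⊗ M → X' ⊗ M'`. -/
def tensMap {X X' : FDMod H} {M M' : FDMod A} (f : X ⟶ X') (g : M ⟶ M') :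
    tens X M ⟶ tens X' M' :=
  ofLin (X := tens X M) (Y := tens X' M') (TensorProduct.map (lin f) (lin g))
    (fun _ z => map_extTensor f g _ z)

@[simp]
theorem lin_tensMap {X X' : FDMod H} {M M' : FDMod A} (f : X ⟶ X') (g : M ⟶ M') :
    lin (tensMap f g) = TensorProduct.map (lin f) (lin g) := rfl

/-- The isomorphism `(X ⊗ Y) ⊗ M ≅ X ⊗ (Y ⊗ M)`. -/
def tensAssoc (X Y : FDMod H) (M : FDMod A) : tens (tens X Y) M ≅ tens X (tens Y M) :=
  isoOfLin (X := tens (tens X Y) M) (Y := tens X (tens Y M))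
    (TensorProduct.assoc ℂ X.carrier Y.carrier M.carrier) (fun a z => by
      have h1 : (tens (tens X Y) M).act a =
          extTensor (extTensor X.act Y.act) M.act (LinearMap.rTensor A Coalgebra.comul
            (LeftComoduleAlgebra.coact (H := H) a)) :=
        extTensor_comp_left (extTensor X.act Y.act) (Bialgebra.comulAlgHom ℂ H) M.act _
      have h2 : (tens X (tens Y M)).act a =
          extTensor X.act (extTensor Y.act M.act) (LinearMap.lTensor H
            (LeftComoduleAlgebra.coact (H := H) (A := A)).toLinearMap
            (LeftComoduleAlgebra.coact (H := H) a)) :=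
        extTensor_comp_right X.act (extTensor Y.act M.act) LeftComoduleAlgebra.coact _
      rw [h1, h2, ← LeftComoduleAlgebra.coassoc]
      exact assoc_extTensor X Y M _ z)

@[simp]
theorem lin_tensAssoc_hom (X Y : FDMod H) (M : FDMod A) :
    lin (tensAssoc X Y M).hom = (TensorProduct.assoc ℂ X.carrier Y.carrier M.carrier).toLinearMap :=
  rfl

@[simp]
theorem lin_tensAssoc_inv (X Y : FDMod H) (M : FDMod A) :
    lin (tensAssoc X Y M).inv =
      (TensorProduct.assoc ℂ X.carrier Y.carrier M.carrier).symm.toLinearMap :=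
  rfl

/-- The isomorphism `ℂ ⊗ M ≅ M`. -/
def tensLeftUnitor (M : FDMod A) : tens (triv H) M ≅ M :=
  isoOfLin (X := tens (triv H) M) (trivTensor M.carrier) (fun a z => by
    have := trivTensor_extTensor M (LeftComoduleAlgebra.coact (H := H) a) z
    rw [LeftComoduleAlgebra.counit] at this
    exact this)

@[simp]
theorem lin_tensLeftUnitor_hom (M : FDMod A) :
    lin (tensLeftUnitor (H := H) M).hom = (trivTensor M.carrier).toLinearMap := rfl

/-- The isomorphism `X ⊗ ℂ ≅ X`. -/
def tensRightUnitor (X : FDMod H) : tens X (triv H) ≅ X :=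
  isoOfLin (X := tens X (triv H)) (tensorTriv X.carrier) (fun a z => by
    have := tensorTriv_extTensor X (Coalgebra.comul (R := ℂ) a) z
    rw [Coalgebra.lTensor_counit_comul, TensorProduct.rid_tmul, one_smul] at this
    exact this)

@[simp]
theorem lin_tensRightUnitor_hom (X : FDMod H) :
    lin (tensRightUnitor X).hom = (tensorTriv X.carrier).toLinearMap := rfl

end Action

section Monoidal

variable {H : Type u} [Ring H] [Bialgebra ℂ H]

instance : MonoidalCategoryStruct (FDMod H) where
  tensorObj X Y := tens X Y
  whiskerLeft X _ _ f := tensMap (𝟙 X) f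
  whiskerRight f Y := tensMap f (𝟙 Y)
  tensorHom f g := tensMap f g
  tensorUnit := triv H
  associator X Y Z := tensAssoc X Y Z
  leftUnitor X := tensLeftUnitor X
  rightUnitor X := tensRightUnitor X

/-- The monoidal category of finite-dimensional `H`-modules. -/
instance : MonoidalCategory (FDMod H) where
  tensorHom_def f g := by
    apply hom_ext; apply TensorProduct.ext'; intro x y; rfl
  id_tensorHom_id X Y := by
    apply hom_ext; apply TensorProduct.ext'; intro x y; rfl
  tensorHom_comp_tensorHom f₁ f₂ g₁ g₂ := by
    apply hom_ext; apply TensorProduct.ext'; intro x y; rfl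
  whiskerLeft_id X Y := by
    apply hom_ext; apply TensorProduct.ext'; intro x y; rfl
  id_whiskerRight X Y := by
    apply hom_ext; apply TensorProduct.ext'; intro x y; rfl
  associator_naturality f₁ f₂ f₃ := by
    apply hom_ext; apply TensorProduct.ext_threefold; intro x y z; rfl
  leftUnitor_naturality f := by
    apply hom_ext; apply TensorProduct.ext'; intro x y
    exact ((lin f).map_smul _ _).symm
  rightUnitor_naturality f := by
    apply hom_ext; apply TensorProduct.ext'; intro x y
    exact ((lin f).map_smul _ _).symm
  pentagon W X Y Z := by
    apply hom_ext; apply TensorProduct.ext_fourfold; intro w x y z; rfl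
  triangle X Y := by
    apply hom_ext; apply TensorProduct.ext_threefold; intro x c y
    exact (TensorProduct.smul_tmul _ _ _).symm

end Monoidal

section MonoidalAction

variable {H A : Type u} [Ring H] [Bialgebra ℂ H] [Ring A] [Algebra ℂ A] [LeftComoduleAlgebra H A]

/-- The category of finite-dimensional `A`-modules is a module category over the monoidal
category of finite-dimensional `H`-modules. -/
instance : MonoidalLeftAction (FDMod H) (FDMod A) where
  actionObj X M := tens X M
  actionHomLeft f M := tensMap f (𝟙 M)
  actionHomRight X _ _ f := tensMap (𝟙 X) f
  actionHom f g := tensMap f g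
  actionAssocIso X Y M := tensAssoc X Y M
  actionUnitIso M := tensLeftUnitor M
  actionHom_def f g := by
    apply hom_ext; apply TensorProduct.ext'; intro x y; rfl
  actionHomRight_id X M := by
    apply hom_ext; apply TensorProduct.ext'; intro x y; rfl
  id_actionHomLeft X M := by
    apply hom_ext; apply TensorProduct.ext'; intro x y; rfl
  actionHom_comp f₁ f₂ g₁ g₂ := by
    apply hom_ext; apply TensorProduct.ext'; intro x y; rfl
  actionAssocIso_hom_naturality f g h := by
    apply hom_ext; apply TensorProduct.ext_threefold; intro x y z; rfl
  actionUnitIso_hom_naturality f := by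
    apply hom_ext; apply TensorProduct.ext'; intro x y
    exact ((lin f).map_smul _ _)
  whiskerLeft_actionHomLeft X _ _ f M := by
    apply hom_ext; apply TensorProduct.ext_threefold; intro x y z; rfl
  whiskerRight_actionHomLeft Y f M := by
    apply hom_ext; apply TensorProduct.ext_threefold; intro x y z; rfl
  associator_actionHom X Y Z M := by
    apply hom_ext; apply TensorProduct.ext_fourfold; intro w x y z; rfl
  leftUnitor_actionHom X M := by
    apply hom_ext; apply TensorProduct.ext_threefold; intro c x m
    exact TensorProduct.smul_tmul' _ _ _
  rightUnitor_actionHom X M := by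
    apply hom_ext; apply TensorProduct.ext_threefold; intro x c m
    exact TensorProduct.smul_tmul _ _ _

end MonoidalAction

end FDMod

/-! ### Module functors -/

section ModuleFunctors

variable (H A B : Type u) [Ring H] [Bialgebra ℂ H] [Ring A] [Algebra ℂ A] [Ring B] [Algebra ℂ B]
  [LeftComoduleAlgebra H A] [LeftComoduleAlgebra H B]

open scoped MonoidalLeftAction
open Functor.OplaxLeftLinear

/-- An oplax `Rep(H)`-module functor from `A`-modules to `B`-modules: a functor `F` with a
natural transformation `F (X ⊗ M) ⟶ X ⊗ F M` satisfying the axioms of a module functor, except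
that it need not be invertible. -/
structure OplaxModuleFunctor where
  toFunctor : FDMod A ⥤ FDMod B
  [oplax : toFunctor.OplaxLeftLinear (FDMod H)]

attribute [instance] OplaxModuleFunctor.oplax

variable {H A B}

/-- Morphisms of module functors: natural transformations that are compatible with the
module functor structures. -/
@[ext]
structure OplaxModuleFunctor.Hom (F G : OplaxModuleFunctor H A B) where
  nat : F.toFunctor ⟶ G.toFunctor
  comm : ∀ (X : FDMod H) (M : FDMod A),
    δₗ F.toFunctor X M ≫ X ⊴ₗ nat.app M = nat.app (X ⊙ₗ M) ≫ δₗ G.toFunctor X M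

instance : Category (OplaxModuleFunctor H A B) where
  Hom F G := OplaxModuleFunctor.Hom F G
  id F := ⟨𝟙 F.toFunctor, fun X M => by simp⟩
  comp α β := ⟨α.nat ≫ β.nat, fun X M => by
    simp [reassoc_of% α.comm, β.comm]⟩
  id_comp α := OplaxModuleFunctor.Hom.ext (Category.id_comp α.nat)
  comp_id α := OplaxModuleFunctor.Hom.ext (Category.comp_id α.nat)
  assoc α β γ := OplaxModuleFunctor.Hom.ext (Category.assoc α.nat β.nat γ.nat)

/-- A functor between module categories is right exact if it turns every exact sequence
`L → M → N → 0` into an exact sequence `F L → F M → F N → 0`. -/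
def IsRightExact (F : FDMod A ⥤ FDMod B) : Prop :=
  ∀ (L M N : FDMod A) (f : L ⟶ M) (g : M ⟶ N),
    Function.Exact (FDMod.lin f) (FDMod.lin g) → Function.Surjective (FDMod.lin g) →
      Function.Exact (FDMod.lin (F.map f)) (FDMod.lin (F.map g)) ∧
        Function.Surjective (FDMod.lin (F.map g))

variable (H A B)

/-- `Rep(H)`-module functors: `ℂ`-linear functors with natural isomorphisms
`F (X ⊗ M) ≅ X ⊗ F M` that satisfy the associativity and unit axioms. -/
def isModuleFunctor : ObjectProperty (OplaxModuleFunctor H A B) := fun F =>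
  F.toFunctor.Additive ∧ F.toFunctor.Linear ℂ ∧
    ∀ (X : FDMod H) (M : FDMod A), IsIso (δₗ F.toFunctor X M)

/-- Right exact `Rep(H)`-module functors. -/
def isRightExactModuleFunctor : ObjectProperty (OplaxModuleFunctor H A B) := fun F =>
  isModuleFunctor H A B F ∧ IsRightExact F.toFunctor

/-- The category `Fun_{Rep(H)}(A-mod, B-mod)` of module functors. -/
abbrev ModuleFunctor : Type (u + 1) := (isModuleFunctor H A B).FullSubcategory

/-- The category of right exact module functors from `A`-mod to `B`-mod. -/
abbrev RightExactModuleFunctor : Type (u + 1) := (isRightExactModuleFunctor H A B).FullSubcategory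

end ModuleFunctors

/-! ### Covariant bimodules -/

section Bimodules

variable (H B A : Type u) [Ring H] [Bialgebra ℂ H] [Ring A] [Algebra ℂ A] [Ring B] [Algebra ℂ B]
  [LeftComoduleAlgebra H A] [LeftComoduleAlgebra H B]

/-- The right regular action of an algebra on itself. -/
def rightMul (R : Type u) [Ring R] [Algebra ℂ R] : Rᵐᵒᵖ →ₐ[ℂ] Module.End ℂ R :=
  Algebra.lsmul ℂ ℂ R

/-- `a ↦ a₍₋₁₎ ⊗ a₍₀₎`, with values in `Hᵐᵒᵖ ⊗ Aᵐᵒᵖ`. -/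
def coactOp : A →ₗ[ℂ] Hᵐᵒᵖ ⊗[ℂ] Aᵐᵒᵖ :=
  TensorProduct.map (MulOpposite.opLinearEquiv ℂ).toLinearMap
      (MulOpposite.opLinearEquiv ℂ).toLinearMap ∘ₗ
    (LeftComoduleAlgebra.coact (H := H) (A := A)).toLinearMap

/-- Left `H`-covariant `B|A`-bimodules (finite-dimensional): `B|A`-bimodules with a left
`H`-coaction that is a homomorphism of bimodules, where
`b (h ⊗ y) a = ∑ b₍₋₁₎ h a₍₋₁₎ ⊗ b₍₀₎ y a₍₀₎` on `H ⊗ Y`. -/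
structure CovBimod where
  carrier : Type u
  [addCommGroup : AddCommGroup carrier]
  [module : Module ℂ carrier]
  [finite : FiniteDimensional ℂ carrier]
  /-- the left action `y ↦ b y` -/
  left : B →ₐ[ℂ] Module.End ℂ carrier
  /-- the right action `y ↦ y a` -/
  right : Aᵐᵒᵖ →ₐ[ℂ] Module.End ℂ carrier
  left_right : ∀ (b : B) (a : A) (y : carrier),
    left b (right (MulOpposite.op a) y) = right (MulOpposite.op a) (left b y)
  coact : carrier →ₗ[ℂ] H ⊗[ℂ] carrier
  coassoc : ∀ y : carrier,
    TensorProduct.assoc ℂ H H carrier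
        (LinearMap.rTensor carrier (Coalgebra.comul : H →ₗ[ℂ] H ⊗[ℂ] H) (coact y)) =
      LinearMap.lTensor H coact (coact y)
  counit : ∀ y : carrier,
    TensorProduct.lid ℂ carrier
        (LinearMap.rTensor carrier (Coalgebra.counit : H →ₗ[ℂ] ℂ) (coact y)) = y
  coact_left : ∀ (b : B) (y : carrier),
    coact (left b y) =
      extTensor (Algebra.lmul ℂ H) left (LeftComoduleAlgebra.coact (H := H) b) (coact y)
  coact_right : ∀ (a : A) (y : carrier),
    coact (right (MulOpposite.op a) y) =
      extTensor (rightMul H) right (coactOp H A a) (coact y)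

attribute [instance] CovBimod.addCommGroup CovBimod.module CovBimod.finite

variable {H B A}

/-- Homomorphisms of bimodules that are also homomorphisms of comodules. -/
@[ext]
structure CovBimod.Hom (Y Z : CovBimod H B A) where
  lin : Y.carrier →ₗ[ℂ] Z.carrier
  map_left : ∀ (b : B) (y : Y.carrier), lin (Y.left b y) = Z.left b (lin y)
  map_right : ∀ (a : A) (y : Y.carrier),
    lin (Y.right (MulOpposite.op a) y) = Z.right (MulOpposite.op a) (lin y)
  map_coact : ∀ y : Y.carrier, LinearMap.lTensor H lin (Y.coact y) = Z.coact (lin y)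

instance : Category (CovBimod H B A) where
  Hom Y Z := CovBimod.Hom Y Z
  id Y := ⟨LinearMap.id, fun _ _ => rfl, fun _ _ => rfl, fun _ => by simp⟩
  comp f g := ⟨g.lin ∘ₗ f.lin, fun b y => by simp [f.map_left, g.map_left],
    fun a y => by simp [f.map_right, g.map_right],
    fun y => by simp [LinearMap.lTensor_comp, f.map_coact, g.map_coact]⟩

end Bimodules

/-! ### The functor `Y ⊗_A -` -/

section BalancedTensor

variable {H B A : Type u} [Ring H] [Bialgebra ℂ H] [Ring A] [Algebra ℂ A] [Ring B] [Algebra ℂ B]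
  [LeftComoduleAlgebra H A] [LeftComoduleAlgebra H B]

/-- The subspace of `Y ⊗ M` spanned by the elements `y a ⊗ m - y ⊗ a m`. -/
def balRel (Y : CovBimod H B A) (M : FDMod A) : Submodule ℂ (Y.carrier ⊗[ℂ] M.carrier) :=
  Submodule.span ℂ {t | ∃ (y : Y.carrier) (a : A) (m : M.carrier),
    t = Y.right (MulOpposite.op a) y ⊗ₜ[ℂ] m - y ⊗ₜ[ℂ] M.act a m}

/-- The tensor product `Y ⊗_A M`. -/
abbrev BalTensor (Y : CovBimod H B A) (M : FDMod A) : Type u :=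
  (Y.carrier ⊗[ℂ] M.carrier) ⧸ balRel Y M

namespace BalTensor

/-- The class of `y ⊗ m` in `Y ⊗_A M`. -/
def mk (Y : CovBimod H B A) (M : FDMod A) : Y.carrier →ₗ[ℂ] M.carrier →ₗ[ℂ] BalTensor Y M :=
  (TensorProduct.mk ℂ Y.carrier M.carrier).compr₂ (balRel Y M).mkQ

theorem mk_balanced (Y : CovBimod H B A) (M : FDMod A) (y : Y.carrier) (a : A) (m : M.carrier) :
    mk Y M (Y.right (MulOpposite.op a) y) m = mk Y M y (M.act a m) :=
  (Submodule.Quotient.eq _).2 (Submodule.subset_span ⟨y, a, m, rfl⟩)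

theorem ext {Y : CovBimod H B A} {M : FDMod A} {W : Type*} [AddCommGroup W] [Module ℂ W]
    {f g : BalTensor Y M →ₗ[ℂ] W} (h : ∀ y m, f (mk Y M y m) = g (mk Y M y m)) : f = g := by
  apply Submodule.linearMap_qext
  apply TensorProduct.ext'
  exact h

theorem ext_comp {Y : CovBimod H B A} {M : FDMod A} {W : Type*} [AddCommGroup W] [Module ℂ W]
    {f g : BalTensor Y M →ₗ[ℂ] W} (h : ∀ y, f ∘ₗ mk Y M y = g ∘ₗ mk Y M y) : f = g :=
  ext fun y m => LinearMap.congr_fun (h y) m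

/-- Linear maps out of `Y ⊗_A M` from balanced linear maps out of `Y ⊗ M`. -/
def lift {Y : CovBimod H B A} {M : FDMod A} {W : Type*} [AddCommGroup W] [Module ℂ W]
    (f : Y.carrier ⊗[ℂ] M.carrier →ₗ[ℂ] W)
    (h : ∀ (y : Y.carrier) (a : A) (m : M.carrier),
      f (Y.right (MulOpposite.op a) y ⊗ₜ[ℂ] m) = f (y ⊗ₜ[ℂ] M.act a m)) :
    BalTensor Y M →ₗ[ℂ] W :=
  (balRel Y M).liftQ f (by
    rw [balRel, Submodule.span_le]
    rintro _ ⟨y, a, m, rfl⟩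
    simp [h])

@[simp]
theorem lift_mk {Y : CovBimod H B A} {M : FDMod A} {W : Type*} [AddCommGroup W] [Module ℂ W]
    (f : Y.carrier ⊗[ℂ] M.carrier →ₗ[ℂ] W)
    (h : ∀ (y : Y.carrier) (a : A) (m : M.carrier),
      f (Y.right (MulOpposite.op a) y ⊗ₜ[ℂ] m) = f (y ⊗ₜ[ℂ] M.act a m))
    (y : Y.carrier) (m : M.carrier) : lift f h (mk Y M y m) = f (y ⊗ₜ[ℂ] m) := rfl

/-- `mk` as a bilinear map on the tensor product over `ℂ`. -/
theorem mkQ_tmul (Y : CovBimod H B A) (M : FDMod A) (y : Y.carrier) (m : M.carrier) :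
    (balRel Y M).mkQ (y ⊗ₜ[ℂ] m) = mk Y M y m := rfl

/-- The linear map `Y ⊗_A M → Z ⊗_A N` induced by a linear map `Y → Z` compatible with the
right actions and a homomorphism `M → N`. -/
def map {Y Z : CovBimod H B A} {M N : FDMod A} (f : Y.carrier →ₗ[ℂ] Z.carrier)
    (hf : ∀ (a : A) (y : Y.carrier),
      f (Y.right (MulOpposite.op a) y) = Z.right (MulOpposite.op a) (f y)) (g : M ⟶ N) :
    BalTensor Y M →ₗ[ℂ] BalTensor Z N :=
  lift ((balRel Z N).mkQ ∘ₗ TensorProduct.map f (FDMod.lin g)) (fun y a m => by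
    simp only [LinearMap.comp_apply, TensorProduct.map_tmul, mkQ_tmul, hf, mk_balanced,
      FDMod.map_act])

@[simp]
theorem map_mk {Y Z : CovBimod H B A} {M N : FDMod A} (f : Y.carrier →ₗ[ℂ] Z.carrier)
    (hf : ∀ (a : A) (y : Y.carrier),
      f (Y.right (MulOpposite.op a) y) = Z.right (MulOpposite.op a) (f y)) (g : M ⟶ N)
    (y : Y.carrier) (m : M.carrier) :
    map f hf g (mk Y M y m) = mk Z N (f y) (FDMod.lin g m) := rfl

/-- The action of `B` on `Y ⊗_A M`, `b (y ⊗ m) = b y ⊗ m`. -/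
def act (Y : CovBimod H B A) (M : FDMod A) : B →ₐ[ℂ] Module.End ℂ (BalTensor Y M) where
  toFun b := map (Y.left b) (fun a y => Y.left_right b a y) (𝟙 M)
  map_one' := by apply ext; intro y m; rw [map_mk]; simp
  map_mul' b c := by
    apply ext; intro y m; rw [map_mk, Module.End.mul_apply, map_mk, map_mk]; simp
  map_zero' := by apply ext; intro y m; rw [map_mk]; simp
  map_add' b c := by
    apply ext; intro y m; rw [LinearMap.add_apply, map_mk, map_mk, map_mk]; simp
  commutes' c := by
    apply ext; intro y m; rw [map_mk]; simp [Module.algebraMap_end_apply]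

@[simp]
theorem act_mk (Y : CovBimod H B A) (M : FDMod A) (b : B) (y : Y.carrier) (m : M.carrier) :
    act Y M b (mk Y M y m) = mk Y M (Y.left b y) m := rfl

/-- The `B`-module `Y ⊗_A M`. -/
def obj (Y : CovBimod H B A) (M : FDMod A) : FDMod B where
  carrier := BalTensor Y M
  act := act Y M

/-- The homomorphism `Y ⊗_A M ⟶ Z ⊗_A N` induced by homomorphisms `Y ⟶ Z` and `M ⟶ N`. -/
def hom {Y Z : CovBimod H B A} {M N : FDMod A} (f : CovBimod.Hom Y Z) (g : M ⟶ N) :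
    obj Y M ⟶ obj Z N :=
  FDMod.ofLin (X := obj Y M) (Y := obj Z N) (map f.lin f.map_right g) (fun b t => by
    have : (map f.lin f.map_right g) ∘ₗ act Y M b =
        act Z N b ∘ₗ (map f.lin f.map_right g) := by
      apply ext; intro y m
      simp [f.map_left]
    exact LinearMap.congr_fun this t)

/-- `(h ⊗ y) ⊗ (x ⊗ m) ↦ h x ⊗ (y ⊗ m)`. -/
def shuffle (Y : CovBimod H B A) {V : Type u} [AddCommGroup V] [Module ℂ V]
    (ρ : H →ₐ[ℂ] Module.End ℂ V) (M : FDMod A) :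
    (H ⊗[ℂ] Y.carrier) ⊗[ℂ] (V ⊗[ℂ] M.carrier) →ₗ[ℂ] V ⊗[ℂ] BalTensor Y M :=
  TensorProduct.map (TensorProduct.lift ρ.toLinearMap) (balRel Y M).mkQ ∘ₗ
    (TensorProduct.tensorTensorTensorComm ℂ H Y.carrier V M.carrier).toLinearMap

@[simp]
theorem shuffle_tmul (Y : CovBimod H B A) {V : Type u} [AddCommGroup V] [Module ℂ V]
    (ρ : H →ₐ[ℂ] Module.End ℂ V) (M : FDMod A) (h : H) (y : Y.carrier) (v : V)
    (m : M.carrier) :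
    shuffle Y ρ M ((h ⊗ₜ[ℂ] y) ⊗ₜ[ℂ] (v ⊗ₜ[ℂ] m)) = ρ h v ⊗ₜ[ℂ] mk Y M y m := by
  simp [shuffle, TensorProduct.tensorTensorTensorComm_tmul]
  rfl

theorem shuffle_balanced (Y : CovBimod H B A) (X : FDMod H) (M : FDMod A) (s : H ⊗[ℂ] A)
    (t : H ⊗[ℂ] Y.carrier) (z : X.carrier ⊗[ℂ] M.carrier) :
    shuffle Y X.act M (extTensor (rightMul H) Y.right (TensorProduct.map
        (MulOpposite.opLinearEquiv ℂ).toLinearMap (MulOpposite.opLinearEquiv ℂ).toLinearMap s) t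
          ⊗ₜ[ℂ] z) =
      shuffle Y X.act M (t ⊗ₜ[ℂ] extTensor X.act M.act s z) := by
  induction s with
  | zero => simp
  | add s s' hs hs' =>
    simp only [map_add, LinearMap.add_apply, TensorProduct.add_tmul, TensorProduct.tmul_add, hs, hs']
  | tmul k a =>
    induction t with
    | zero => simp
    | add t t' ht ht' => simp only [map_add, TensorProduct.add_tmul, ht, ht']
    | tmul h y =>
      induction z with
      | zero => simp
      | add z z' hz hz' => simp only [map_add, TensorProduct.tmul_add, hz, hz']
      | tmul x m =>
        simp only [TensorProduct.map_tmul, extTensor_tmul, LinearEquiv.coe_coe,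
          MulOpposite.coe_opLinearEquiv, shuffle_tmul, mk_balanced]
        simp [rightMul]

theorem shuffle_left (Y : CovBimod H B A) (X : FDMod H) (M : FDMod A) (s : H ⊗[ℂ] B)
    (t : H ⊗[ℂ] Y.carrier) (z : X.carrier ⊗[ℂ] M.carrier) :
    shuffle Y X.act M (extTensor (Algebra.lmul ℂ H) Y.left s t ⊗ₜ[ℂ] z) =
      extTensor X.act (act Y M) s (shuffle Y X.act M (t ⊗ₜ[ℂ] z)) := by
  induction s with
  | zero => simp
  | add s s' hs hs' =>
    simp only [map_add, LinearMap.add_apply, TensorProduct.add_tmul, hs, hs']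
  | tmul k a =>
    induction t with
    | zero => simp
    | add t t' ht ht' => simp only [map_add, TensorProduct.add_tmul, ht, ht']
    | tmul h y =>
      induction z with
      | zero => simp
      | add z z' hz hz' => simp only [map_add, TensorProduct.tmul_add, hz, hz']
      | tmul x m =>
        simp

/-- The linear map `Y ⊗_A (X ⊗ M) → X ⊗ (Y ⊗_A M)`,
`y ⊗ (x ⊗ m) ↦ ∑ y₍₋₁₎ x ⊗ (y₍₀₎ ⊗ m)`. -/
def oplaxLin (Y : CovBimod H B A) (X : FDMod H) (M : FDMod A) :
    BalTensor Y (FDMod.tens X M) →ₗ[ℂ] X.carrier ⊗[ℂ] BalTensor Y M :=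
  lift (M := FDMod.tens X M) (shuffle Y X.act M ∘ₗ LinearMap.rTensor _ Y.coact) (fun y a z => by
    have := shuffle_balanced Y X M (LeftComoduleAlgebra.coact (H := H) a) (Y.coact y) z
    change shuffle Y X.act M (Y.coact (Y.right (MulOpposite.op a) y) ⊗ₜ[ℂ] z) = _
    rw [Y.coact_right]
    exact this)

theorem oplaxLin_mk (Y : CovBimod H B A) (X : FDMod H) (M : FDMod A) (y : Y.carrier)
    (z : X.carrier ⊗[ℂ] M.carrier) :
    oplaxLin Y X M (mk Y (FDMod.tens X M) y z) = shuffle Y X.act M (Y.coact y ⊗ₜ[ℂ] z) := rfl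

/-- The homomorphism of `B`-modules `Y ⊗_A (X ⊗ M) ⟶ X ⊗ (Y ⊗_A M)`. -/
def oplaxHom (Y : CovBimod H B A) (X : FDMod H) (M : FDMod A) :
    obj Y (FDMod.tens X M) ⟶ FDMod.tens X (obj Y M) :=
  FDMod.ofLin (X := obj Y (FDMod.tens X M)) (Y := FDMod.tens X (obj Y M)) (oplaxLin Y X M)
    (fun b t => by
      have : oplaxLin Y X M ∘ₗ (obj Y (FDMod.tens X M)).act b =
          (FDMod.tens X (obj Y M)).act b ∘ₗ oplaxLin Y X M := by
        apply ext; intro y z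
        change shuffle Y X.act M (Y.coact (Y.left b y) ⊗ₜ[ℂ] z) = _
        rw [Y.coact_left]
        exact shuffle_left Y X M _ _ z
      exact LinearMap.congr_fun this t)

theorem lin_oplaxHom (Y : CovBimod H B A) (X : FDMod H) (M : FDMod A) :
    FDMod.lin (oplaxHom Y X M) = oplaxLin Y X M := rfl

/-- The functor `Y ⊗_A -` from `A`-modules to `B`-modules. -/
def functor (Y : CovBimod H B A) : FDMod A ⥤ FDMod B where
  obj M := obj Y M
  map g := hom (𝟙 Y : Y ⟶ Y) g
  map_id M := by apply FDMod.hom_ext; apply ext; intro y m; rfl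
  map_comp f g := by apply FDMod.hom_ext; apply ext; intro y m; rfl

open scoped MonoidalLeftAction

/-- The linear map `(h ⊗ (k ⊗ y)) ↦ h x ⊗ (k x' ⊗ (y ⊗ m))`. -/
def shuffle₃ (Y : CovBimod H B A) (X X' : FDMod H) (M : FDMod A)
    (x : X.carrier) (x' : X'.carrier) (m : M.carrier) :
    H ⊗[ℂ] (H ⊗[ℂ] Y.carrier) →ₗ[ℂ] X.carrier ⊗[ℂ] (X'.carrier ⊗[ℂ] BalTensor Y M) :=
  TensorProduct.map (X.act.toLinearMap.flip x)
    (TensorProduct.map (X'.act.toLinearMap.flip x') ((mk Y M).flip m))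

theorem shuffle₃_left (Y : CovBimod H B A) (X X' : FDMod H) (M : FDMod A)
    (x : X.carrier) (x' : X'.carrier) (m : M.carrier) (t : H ⊗[ℂ] Y.carrier) :
    TensorProduct.assoc ℂ X.carrier X'.carrier (BalTensor Y M)
        (shuffle Y ((extTensor X.act X'.act).comp (Bialgebra.comulAlgHom ℂ H)) M
          (t ⊗ₜ[ℂ] ((x ⊗ₜ[ℂ] x') ⊗ₜ[ℂ] m))) =
      shuffle₃ Y X X' M x x' m (TensorProduct.assoc ℂ H H Y.carrier
        (LinearMap.rTensor Y.carrier (Coalgebra.comul : H →ₗ[ℂ] H ⊗[ℂ] H) t)) := by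
  induction t with
  | zero => simp
  | add t t' ht ht' => simp only [map_add, TensorProduct.add_tmul, ht, ht']
  | tmul h y =>
    rw [shuffle_tmul, LinearMap.rTensor_tmul, AlgHom.comp_apply, Bialgebra.comulAlgHom_apply]
    induction (Coalgebra.comul (R := ℂ) h) with
    | zero => simp
    | add s s' hs hs' =>
      simp only [map_add, TensorProduct.add_tmul, LinearMap.add_apply, hs, hs']
    | tmul k l => simp [shuffle₃]

theorem shuffle₃_right (Y : CovBimod H B A) (X X' : FDMod H) (M : FDMod A)
    (x : X.carrier) (x' : X'.carrier) (m : M.carrier) (t : H ⊗[ℂ] Y.carrier) :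
    TensorProduct.map (LinearMap.id : X.carrier →ₗ[ℂ] X.carrier) (oplaxLin Y X' M)
        (shuffle Y X.act (FDMod.tens X' M) (t ⊗ₜ[ℂ] (x ⊗ₜ[ℂ] (x' ⊗ₜ[ℂ] m)))) =
      shuffle₃ Y X X' M x x' m (LinearMap.lTensor H Y.coact t) := by
  induction t with
  | zero => simp
  | add t t' ht ht' => simp only [map_add, TensorProduct.add_tmul, ht, ht']
  | tmul h y =>
    have h1 : shuffle Y X.act (FDMod.tens X' M) ((h ⊗ₜ[ℂ] y) ⊗ₜ[ℂ] (x ⊗ₜ[ℂ] (x' ⊗ₜ[ℂ] m))) =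
        X.act h x ⊗ₜ[ℂ] mk Y (FDMod.tens X' M) y (x' ⊗ₜ[ℂ] m) :=
      shuffle_tmul Y X.act (FDMod.tens X' M) h y x (x' ⊗ₜ[ℂ] m)
    rw [h1, TensorProduct.map_tmul, oplaxLin_mk, LinearMap.lTensor_tmul]
    induction (Y.coact y) with
    | zero => simp
    | add s s' hs hs' =>
      simp only [map_add, TensorProduct.add_tmul, TensorProduct.tmul_add, hs, hs']
    | tmul k l => simp [shuffle₃]

theorem shuffle_triv (Y : CovBimod H B A) (M : FDMod A) (c : ULift.{u} ℂ) (m : M.carrier)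
    (t : H ⊗[ℂ] Y.carrier) :
    FDMod.trivTensor (BalTensor Y M) (shuffle Y (FDMod.trivAct H) M (t ⊗ₜ[ℂ] (c ⊗ₜ[ℂ] m))) =
      mk Y M (TensorProduct.lid ℂ Y.carrier (LinearMap.rTensor Y.carrier Coalgebra.counit t))
        (c.down • m) := by
  induction t with
  | zero => simp
  | add t t' ht ht' => simp only [map_add, TensorProduct.add_tmul, LinearMap.add_apply, ht, ht']
  | tmul h y =>
    simp [FDMod.trivAct_apply]
    rw [mul_smul]
    exact smul_comm (Coalgebra.counit (R := ℂ) h) c.down (mk Y M y m)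

theorem shuffle_map {Y Z : CovBimod H B A} (f : CovBimod.Hom Y Z) {X X' : FDMod H}
    {M M' : FDMod A} (g : X ⟶ X') (k : M ⟶ M') (t : H ⊗[ℂ] Y.carrier)
    (z : X.carrier ⊗[ℂ] M.carrier) :
    TensorProduct.map (FDMod.lin g) (map f.lin f.map_right k) (shuffle Y X.act M (t ⊗ₜ[ℂ] z)) =
      shuffle Z X'.act M' (LinearMap.lTensor H f.lin t ⊗ₜ[ℂ]
        TensorProduct.map (FDMod.lin g) (FDMod.lin k) z) := by
  induction t with
  | zero => simp
  | add t t' ht ht' => simp only [map_add, TensorProduct.add_tmul, ht, ht']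
  | tmul h y =>
    induction z with
    | zero => simp
    | add z z' hz hz' => simp only [map_add, TensorProduct.tmul_add, hz, hz']
    | tmul x m => simp [FDMod.map_act]

/-- Naturality of `Y ⊗_A (X ⊗ M) ⟶ X ⊗ (Y ⊗_A M)` in all three variables. -/
theorem oplaxHom_naturality {Y Z : CovBimod H B A} (f : Y ⟶ Z) {X X' : FDMod H}
    {M M' : FDMod A} (g : X ⟶ X') (k : M ⟶ M') :
    hom f (FDMod.tensMap g k) ≫ oplaxHom Z X' M' =
      oplaxHom Y X M ≫ FDMod.tensMap g (hom f k) := by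
  apply FDMod.hom_ext
  apply ext (M := FDMod.tens X M)
  intro y z
  have := shuffle_map f g k (Y.coact y) z
  rw [f.map_coact] at this
  exact this.symm

theorem hom_id (Y : CovBimod H B A) (M : FDMod A) : hom (𝟙 Y : Y ⟶ Y) (𝟙 M) = 𝟙 (obj Y M) := by
  apply FDMod.hom_ext; apply ext; intro y m; rfl

theorem oplaxHom_assoc (Y : CovBimod H B A) (X X' : FDMod H) (M : FDMod A) :
    oplaxHom Y (FDMod.tens X X') M ≫ (FDMod.tensAssoc X X' (obj Y M)).hom =
      hom (𝟙 Y : Y ⟶ Y) (FDMod.tensAssoc X X' M).hom ≫ oplaxHom Y X (FDMod.tens X' M) ≫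
        FDMod.tensMap (𝟙 X) (oplaxHom Y X' M) := by
  apply FDMod.hom_ext
  apply ext_comp (M := FDMod.tens (FDMod.tens X X') M)
  intro y
  apply TensorProduct.ext_threefold (R := ℂ)
  intro x x' m
  have h1 := shuffle₃_left Y X X' M x x' m (Y.coact y)
  rw [Y.coassoc, ← shuffle₃_right] at h1
  exact h1

theorem oplaxHom_unit (Y : CovBimod H B A) (M : FDMod A) :
    oplaxHom Y (FDMod.triv H) M ≫ (FDMod.tensLeftUnitor (obj Y M)).hom =
      hom (𝟙 Y : Y ⟶ Y) (FDMod.tensLeftUnitor M).hom := by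
  apply FDMod.hom_ext
  apply ext_comp (M := FDMod.tens (FDMod.triv H) M)
  intro y
  apply TensorProduct.ext' (R := ℂ)
  intro c m
  have h1 := shuffle_triv Y M c m (Y.coact y)
  rw [Y.counit] at h1
  exact h1

/-- The oplax module functor structure of `Y ⊗_A -`. -/
instance (Y : CovBimod H B A) : (functor Y).OplaxLeftLinear (FDMod H) where
  δₗ X M := oplaxHom Y X M
  δₗ_naturality_left {X X'} g M := by
    have := oplaxHom_naturality (𝟙 Y) g (𝟙 M)
    rw [hom_id] at this
    exact this
  δₗ_naturality_right X _ _ k := oplaxHom_naturality (𝟙 Y) (𝟙 X) k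
  δₗ_associativity X X' M := oplaxHom_assoc Y X X' M
  δₗ_unitality_inv M := by
    have h1 := oplaxHom_unit Y M
    have h2 : hom (𝟙 Y : Y ⟶ Y) (FDMod.tensLeftUnitor (H := H) M).inv ≫
        hom (𝟙 Y : Y ⟶ Y) (FDMod.tensLeftUnitor (H := H) M).hom = 𝟙 (obj Y M) :=
      ((functor Y).mapIso (FDMod.tensLeftUnitor (H := H) M)).inv_hom_id
    have h3 : (FDMod.tensLeftUnitor (H := H) (obj Y M)).inv =
        hom (𝟙 Y : Y ⟶ Y) (FDMod.tensLeftUnitor (H := H) M).inv ≫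
          oplaxHom Y (FDMod.triv H) M := by
      rw [← Category.id_comp (FDMod.tensLeftUnitor (H := H) (obj Y M)).inv, Iso.comp_inv_eq,
        Category.assoc, h1, h2]
    exact h3

end BalTensor

/-- The functor that sends a covariant bimodule `Y` to the functor `Y ⊗_A -`, with the oplax
module functor structure `y ⊗ (x ⊗ m) ↦ ∑ y₍₋₁₎ x ⊗ (y₍₀₎ ⊗ m)`. -/
def tensorFunctor (H B A : Type u) [Ring H] [Bialgebra ℂ H] [Ring A] [Algebra ℂ A]
    [Ring B] [Algebra ℂ B] [LeftComoduleAlgebra H A] [LeftComoduleAlgebra H B] :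
    CovBimod H B A ⥤ OplaxModuleFunctor H A B where
  obj Y := ⟨BalTensor.functor Y⟩
  map {Y Z} f :=
    { nat :=
        { app := fun M => BalTensor.hom f (𝟙 M)
          naturality := fun M N g => by
            apply FDMod.hom_ext; apply BalTensor.ext; intro y m; rfl }
      comm := fun X M => by
        have h := BalTensor.oplaxHom_naturality f (𝟙 X) (𝟙 M)
        have h1 : FDMod.tensMap (𝟙 X) (𝟙 M) = 𝟙 (FDMod.tens X M) := by
          apply FDMod.hom_ext; apply TensorProduct.ext'; intro x m; rfl
        rw [h1] at h
        exact h.symm }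
  map_id Y := by
    apply OplaxModuleFunctor.Hom.ext; apply NatTrans.ext; funext M
    apply FDMod.hom_ext; apply BalTensor.ext; intro y m; rfl
  map_comp f g := by
    apply OplaxModuleFunctor.Hom.ext; apply NatTrans.ext; funext M
    apply FDMod.hom_ext; apply BalTensor.ext; intro y m; rfl

end BalancedTensor

end HopfBoundary

end

open HopfBoundary

/-! The inverse of `Y ↦ Y ⊗_A -` sends a module functor `F` to `F A`, as in the Eilenberg–Watts
theorem. The left `B`-action is that of the module `F A`, and functoriality in the right
multiplications `A ⟶ A` gives a right `A`-action. The coaction is new. Since `a (1 ⊗ 1) = a₍₋₁₎ ⊗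
a₍₀₎` in `H ⊗ A`, the coaction of `A` is a module homomorphism `A ⟶ H ⊗ A`, and `F A ⟶ F (H ⊗ A) ⟶ H
⊗ F A` is a coaction on `F A`. Its axioms follow from those of `A` by naturality and the module
functor axioms (`coactNat_coassoc`, `coactNat_counit`, `lin_str_mapGen`).

The maps `y ⊗ m ↦ F(a ↦ a m) y` form a morphism of module functors `F A ⊗_A - ⟶ F` (`eval`), because
every `x ⊗ m` is the image of `1` under `A ⟶ H ⊗ A ⟶ X ⊗ M` (`coactHom_tensMap`). It is invertible
at `A`, hence at direct summands of free modules by additivity; this covers all modules if `A` is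
semisimple. If `F` is right exact, free presentations extend this to all modules
(`isIso_app_of_isRightExact`). Full faithfulness comes from evaluating at `A` on the elements `y ⊗
1`.

It remains to see that `Y ⊗_A -` is a right exact module functor. Its structure map `y ⊗ (x ⊗ m) ↦
y₍₋₁₎ x ⊗ (y₍₀₎ ⊗ m)` has the inverse `x ⊗ (y ⊗ m) ↦ y₍₀₎ ⊗ (S⁻¹(y₍₋₁₎) x ⊗ m)`, so the antipode `S`
must be bijective. Finite dimension gives this by a Fitting decomposition for `S²`, combined with
the fact that algebra homomorphisms agreeing after composition with `S` are equal
(`algHom_ext_antipode`). -/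

noncomputable section

namespace HopfBoundary

/-! ### The antipode of a finite-dimensional Hopf algebra is bijective -/

section Antipode

open HopfAlgebra Coalgebra

variable {H : Type u} [Ring H] [HopfAlgebra ℂ H]

open WithConv in
/-- An algebra homomorphism `φ` is determined by `φ ∘ S`, because it is the convolution inverse of
`φ ∘ S`. -/
theorem algHom_ext_antipode {R : Type*} [Ring R] [Algebra ℂ R] {φ ψ : H →ₐ[ℂ] R}
    (h : ∀ x, φ (antipode ℂ x) = ψ (antipode ℂ x)) : φ = ψ := by
  have hS : φ.toLinearMap ∘ₗ antipode ℂ = ψ.toLinearMap ∘ₗ antipode ℂ := LinearMap.ext h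
  have h1 : ∀ χ : H →ₐ[ℂ] R,
      toConv χ.toLinearMap * toConv (χ.toLinearMap ∘ₗ antipode ℂ) = 1 := by
    intro χ
    ext c
    rw [(ℛ ℂ c).convMul_apply]
    simp only [LinearMap.comp_apply, AlgHom.toLinearMap_apply, ← map_mul, ← map_sum,
      sum_mul_antipode_eq_algebraMap_counit (ℛ ℂ c)]
    simp
  have h2 : toConv (φ.toLinearMap ∘ₗ antipode ℂ) * toConv φ.toLinearMap = 1 := by
    ext c
    rw [(ℛ ℂ c).convMul_apply]
    simp only [LinearMap.comp_apply, AlgHom.toLinearMap_apply, ← map_mul, ← map_sum,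
      sum_antipode_mul_eq_algebraMap_counit (ℛ ℂ c)]
    simp
  have h3 := h1 ψ
  rw [← hS] at h3
  exact AlgHom.toLinearMap_injective
    (toConv_injective (left_inv_eq_right_inv (h1 φ) h2 |>.trans
      (left_inv_eq_right_inv h3 h2).symm))

variable (H) in
/-- The square of the antipode, as an algebra homomorphism. -/
def antipodeSq : H →ₐ[ℂ] H :=
  AlgHom.ofLinearMap (antipode ℂ ∘ₗ antipode ℂ) (by simp)
    (fun x y => by simp [antipode_mul_antidistrib])

theorem antipodeSq_apply (x : H) : antipodeSq H x = antipode ℂ (antipode ℂ x) := rfl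

theorem antipodeSq_pow_antipode (k : ℕ) (x : H) :
    (antipodeSq H ^ k) (antipode ℂ x) = antipode ℂ ((antipodeSq H ^ k) x) := by
  induction k generalizing x with
  | zero => simp
  | succ k ih => simp only [pow_succ, AlgHom.mul_apply, antipodeSq_apply, ih]

/-- An algebra endomorphism that fixes the range of a power of `S²` is the identity. -/
theorem eq_id_of_comp_antipodeSq_pow (p : H →ₐ[ℂ] H) (k : ℕ)
    (hp : ∀ x, p ((antipodeSq H ^ k) x) = (antipodeSq H ^ k) x) : ∀ x, p x = x := by
  induction k with
  | zero => simpa using hp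
  | succ k ih =>
    apply ih
    -- One factor `S²` is removed as two factors `S`. For the first, `S ∘ (S²)^k` has to be read as
    -- an algebra homomorphism into `Hᵐᵒᵖ`.
    have h1 : (AlgHom.op p).comp ((antipodeAlgHomOp ℂ H).comp (antipodeSq H ^ k)) =
        (antipodeAlgHomOp ℂ H).comp (antipodeSq H ^ k) := by
      apply algHom_ext_antipode
      intro x
      have := hp x
      rw [pow_succ, AlgHom.mul_apply, antipodeSq_apply, antipodeSq_pow_antipode] at this
      simpa using! this
    have h2 : p.comp (antipodeSq H ^ k) = antipodeSq H ^ k := by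
      apply algHom_ext_antipode
      intro x
      have := AlgHom.congr_fun h1 x
      rw [AlgHom.comp_apply, antipodeSq_pow_antipode]
      exact MulOpposite.op_injective this
    exact AlgHom.congr_fun h2

/-- For large `k` the power `T = (S²)^k` is invertible on its range, so `T` followed by the inverse
of that restriction is an algebra projection `p` onto the range of `T`. Since `p ∘ T = T`,
cancelling `S` repeatedly gives `p = id`. But `p` kills `ker T`, which contains `ker S`. -/
theorem antipode_injective [FiniteDimensional ℂ H] :
    Function.Injective (antipode ℂ : H →ₗ[ℂ] H) := by
  -- Fitting: kernel and range of `(S²)^k` are complementary for large `k`. Positivity of `k` is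
  -- what puts `ker S` inside `ker T`.
  obtain ⟨k, hk, hk0⟩ := ((LinearMap.eventually_isCompl_ker_pow_range_pow
    (antipodeSq H).toLinearMap).and (Filter.eventually_gt_atTop 0)).exists
  have hpow : ∀ x, ((antipodeSq H).toLinearMap ^ k) x = (antipodeSq H ^ k) x := by
    intro x
    rw [Module.End.pow_apply, AlgHom.coe_pow]
    rfl
  set T := antipodeSq H ^ k with hT
  let r : T.range →ₐ[ℂ] T.range := T.rangeRestrict.comp T.range.val
  have hr : Function.Injective r := by
    rw [injective_iff_map_eq_zero]
    rintro ⟨x, y, hy⟩ h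
    have h0 : T x = 0 := congrArg Subtype.val h
    apply Subtype.ext
    refine (Submodule.disjoint_def.1 hk.disjoint) x ?_ ?_
    · rw [LinearMap.mem_ker, hpow, h0]
    · exact ⟨y, (hpow y).trans hy⟩
  let e : T.range ≃ₐ[ℂ] T.range := AlgEquiv.ofBijective r
    ⟨hr, (LinearMap.injective_iff_surjective (f := r.toLinearMap)).1 hr⟩
  let p : H →ₐ[ℂ] H := T.range.val.comp (e.symm.toAlgHom.comp T.rangeRestrict)
  have hp : ∀ x, p (T x) = T x := by
    intro x
    have : T.rangeRestrict (T x) = e (T.rangeRestrict x) := rfl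
    change ((e.symm (T.rangeRestrict (T x)) : T.range) : H) = T x
    rw [this, AlgEquiv.symm_apply_apply]
    rfl
  have hid := eq_id_of_comp_antipodeSq_pow p k hp
  rw [injective_iff_map_eq_zero]
  intro x hx
  have h1 : T x = 0 := by
    obtain ⟨n, rfl⟩ := Nat.exists_eq_succ_of_ne_zero hk0.ne'
    rw [hT, pow_succ, AlgHom.mul_apply, antipodeSq_apply, hx]
    simp
  rw [← hid x]
  change ((e.symm (T.rangeRestrict x) : T.range) : H) = 0
  have : T.rangeRestrict x = 0 := Subtype.ext h1
  rw [this]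
  simp

/-- If `q(h₍₁₎, h₍₂₎) = ε(h)` then `q(v₍₋₁₎, v₍₀₎₍₋₁₎) ⊗ v₍₀₎₍₀₎ = 1 ⊗ v` for a coaction on `V`. -/
theorem rTensor_lTensor_coact {V : Type*} [AddCommGroup V] [Module ℂ V]
    (ρ : V →ₗ[ℂ] H ⊗[ℂ] V) (v : V)
    (coassoc : TensorProduct.assoc ℂ H H V
        (LinearMap.rTensor V (comul : H →ₗ[ℂ] H ⊗[ℂ] H) (ρ v)) = LinearMap.lTensor H ρ (ρ v))
    (hcounit : TensorProduct.lid ℂ V (LinearMap.rTensor V (counit : H →ₗ[ℂ] ℂ) (ρ v)) = v)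
    (q : H ⊗[ℂ] H →ₗ[ℂ] H)
    (hq : ∀ h : H, q (comul (R := ℂ) h) = algebraMap ℂ H (counit h)) :
    LinearMap.rTensor V q ((TensorProduct.assoc ℂ H H V).symm (LinearMap.lTensor H ρ (ρ v))) =
      1 ⊗ₜ[ℂ] v := by
  rw [← coassoc, LinearEquiv.symm_apply_apply]
  conv_rhs => rw [← hcounit]
  induction ρ v with
  | zero => simp
  | add s t hs ht => simp only [map_add, TensorProduct.tmul_add, hs, ht]
  | tmul x y => simp [hq, Algebra.algebraMap_eq_smul_one, TensorProduct.smul_tmul]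

variable (H) [FiniteDimensional ℂ H]

/-- The inverse of the antipode. -/
def skewAntipode : H →ₗ[ℂ] H :=
  (LinearEquiv.ofInjectiveEndo (antipode ℂ : H →ₗ[ℂ] H) antipode_injective).symm.toLinearMap

variable {H}

theorem antipode_skewAntipode (x : H) : antipode ℂ (skewAntipode H x) = x :=
  (LinearEquiv.ofInjectiveEndo (antipode ℂ : H →ₗ[ℂ] H) antipode_injective).apply_symm_apply x

/-- `∑ S⁻¹(h₍₂₎) h₍₁₎ = ε(h)`. -/
theorem skewAntipode_mul_comul (h : H) :
    TensorProduct.lift ((LinearMap.mul ℂ H).flip.compl₂ (skewAntipode H)) (comul (R := ℂ) h) =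
      algebraMap ℂ H (counit h) := by
  -- Applying `S`, which reverses products, turns the claim into the axiom `∑ S(h₍₁₎) h₍₂₎ = ε(h)`.
  apply antipode_injective
  have : antipode ℂ (algebraMap ℂ H (counit h)) = algebraMap ℂ H (counit h) := by
    simp [Algebra.algebraMap_eq_smul_one]
  rw [this, ← mul_antipode_rTensor_comul_apply]
  induction comul (R := ℂ) h with
  | zero => simp
  | add s t hs ht => simp only [map_add, hs, ht]
  | tmul x y => simp [antipode_mul_antidistrib, antipode_skewAntipode]

/-- `∑ h₍₂₎ S⁻¹(h₍₁₎) = ε(h)`. -/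
theorem mul_skewAntipode_comul (h : H) :
    TensorProduct.lift ((LinearMap.mul ℂ H).flip ∘ₗ (skewAntipode H)) (comul (R := ℂ) h) =
      algebraMap ℂ H (counit h) := by
  apply antipode_injective
  have : antipode ℂ (algebraMap ℂ H (counit h)) = algebraMap ℂ H (counit h) := by
    simp [Algebra.algebraMap_eq_smul_one]
  rw [this, ← mul_antipode_lTensor_comul_apply]
  induction comul (R := ℂ) h with
  | zero => simp
  | add s t hs ht => simp only [map_add, hs, ht]
  | tmul x y => simp [antipode_mul_antidistrib, antipode_skewAntipode]

theorem skewAntipode_mul (x y : H) :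
    skewAntipode H (x * y) = skewAntipode H y * skewAntipode H x := by
  apply antipode_injective
  rw [antipode_mul_antidistrib]
  simp only [antipode_skewAntipode]

end Antipode

/-! ### The functor `Y ⊗_A -` is a right exact module functor -/

namespace BalTensor

open HopfAlgebra Coalgebra

/-! ### Additivity, linearity and right exactness of `Y ⊗_A -`. -/

section RightExact

variable {H B A : Type u} [Ring H] [Bialgebra ℂ H] [Ring A] [Algebra ℂ A]
  [Ring B] [Algebra ℂ B] [LeftComoduleAlgebra H A] [LeftComoduleAlgebra H B]

/-- The class of `y ⊗ (x ⊗ m)` in `Y ⊗_A (X ⊗ M)`. -/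
def mkTens (Y : CovBimod H B A) (X : FDMod H) (M : FDMod A) :
    Y.carrier →ₗ[ℂ] X.carrier ⊗[ℂ] M.carrier →ₗ[ℂ] BalTensor Y (FDMod.tens X M) :=
  mk Y (FDMod.tens X M)

theorem mkTens_balanced (Y : CovBimod H B A) (X : FDMod H) (M : FDMod A) (y : Y.carrier) (a : A)
    (z : X.carrier ⊗[ℂ] M.carrier) :
    mkTens Y X M (Y.right (MulOpposite.op a) y) z =
      mkTens Y X M y (extTensor X.act M.act (LeftComoduleAlgebra.coact (H := H) a) z) :=
  mk_balanced Y (FDMod.tens X M) y a z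

theorem oplaxLin_mkTens (Y : CovBimod H B A) (X : FDMod H) (M : FDMod A) (y : Y.carrier)
    (z : X.carrier ⊗[ℂ] M.carrier) :
    oplaxLin Y X M (mkTens Y X M y z) = shuffle Y X.act M (Y.coact y ⊗ₜ[ℂ] z) := rfl

theorem ext_tens {Y : CovBimod H B A} {X : FDMod H} {M : FDMod A} {W : Type*} [AddCommGroup W]
    [Module ℂ W] {f g : BalTensor Y (FDMod.tens X M) →ₗ[ℂ] W}
    (h : ∀ y x m, f (mkTens Y X M y (x ⊗ₜ[ℂ] m)) = g (mkTens Y X M y (x ⊗ₜ[ℂ] m))) : f = g := by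
  apply ext_comp
  intro y
  apply TensorProduct.ext' (M := X.carrier) (N := M.carrier)
  exact h y

theorem induction {Y : CovBimod H B A} {M : FDMod A} {P : BalTensor Y M → Prop}
    (zero : P 0) (mk : ∀ y m, P (mk Y M y m)) (add : ∀ s t, P s → P t → P (s + t))
    (t : BalTensor Y M) : P t := by
  obtain ⟨t, rfl⟩ := (balRel Y M).mkQ_surjective t
  induction t with
  | zero => simpa using zero
  | add s t hs ht => rw [map_add]; exact add _ _ hs ht
  | tmul y m => exact mk y m

instance (Y : CovBimod H B A) : (functor Y).Additive where
  map_add {M N f g} := by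
    apply FDMod.hom_ext; apply ext; intro y m
    exact map_add (mk Y N y) (FDMod.lin f m) (FDMod.lin g m)

instance (Y : CovBimod H B A) : (functor Y).Linear ℂ where
  map_smul {M N} f c := by
    apply FDMod.hom_ext; apply ext; intro y m
    exact map_smul (mk Y N y) c (FDMod.lin f m)

/-- The kernel of `ψ` lies in the range of `φ` because the projection onto the cokernel of `φ`
factors through `ψ`: send `y ⊗ n` to the class of `y ⊗ m` for any lift `m` of `n`. Two lifts differ
by an element of the range of `f`, so the class does not depend on the lift. -/
theorem exact_and_surjective {Y : CovBimod H B A} {L M N : FDMod A} {f : L ⟶ M} {g : M ⟶ N}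
    (hex : Function.Exact (FDMod.lin f) (FDMod.lin g)) (hg : Function.Surjective (FDMod.lin g))
    {φ : BalTensor Y L →ₗ[ℂ] BalTensor Y M} {ψ : BalTensor Y M →ₗ[ℂ] BalTensor Y N}
    (hφ : ∀ y l, φ (mk Y L y l) = mk Y M y (FDMod.lin f l))
    (hψ : ∀ y m, ψ (mk Y M y m) = mk Y N y (FDMod.lin g m)) :
    Function.Exact φ ψ ∧ Function.Surjective ψ := by
  constructor
  · intro z
    constructor
    · intro hz
      -- The section `s` is only `ℂ`-linear. Independence of the lift (`hR`) makes `χ` balanced all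
      -- the same.
      obtain ⟨s, hs⟩ := (FDMod.lin g).exists_rightInverse_of_surjective
        (LinearMap.range_eq_top.2 hg)
      have hs' : ∀ n, FDMod.lin g (s n) = n := LinearMap.congr_fun hs
      have hR : ∀ y m m', FDMod.lin g m = FDMod.lin g m' →
          (LinearMap.range φ).mkQ (mk Y M y m) = (LinearMap.range φ).mkQ (mk Y M y m') := by
        intro y m m' h
        obtain ⟨l, hl⟩ := (hex (m - m')).1 (by rw [map_sub, h, sub_self])
        refine (Submodule.Quotient.eq _).2 ⟨mk Y L y l, ?_⟩
        rw [hφ, hl, map_sub]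
      let χ : BalTensor Y N →ₗ[ℂ] BalTensor Y M ⧸ LinearMap.range φ := lift (M := N)
        ((LinearMap.range φ).mkQ ∘ₗ TensorProduct.lift ((mk Y M).compl₂ s)) (fun y a n => by
          simp only [LinearMap.comp_apply, TensorProduct.lift.tmul, LinearMap.compl₂_apply,
            mk_balanced]
          apply hR
          rw [FDMod.map_act, hs', hs'])
      have hχ : χ ∘ₗ ψ = (LinearMap.range φ).mkQ := by
        apply ext
        intro y m
        rw [LinearMap.comp_apply, hψ]
        exact hR _ _ _ (hs' _)
      have h0 : (LinearMap.range φ).mkQ z = 0 := by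
        rw [← hχ, LinearMap.comp_apply, hz, map_zero]
      exact (Submodule.Quotient.mk_eq_zero _).1 h0
    · rintro ⟨z, rfl⟩
      have h0 : ψ ∘ₗ φ = 0 := by
        apply ext
        intro y m
        rw [LinearMap.comp_apply, hφ, hψ, hex.apply_apply_eq_zero, map_zero, LinearMap.zero_apply]
      exact LinearMap.congr_fun h0 z
  · intro z
    refine induction (P := fun z => ∃ w, ψ w = z) ⟨0, map_zero _⟩ ?_ ?_ z
    · intro y n
      obtain ⟨m, rfl⟩ := hg n
      exact ⟨mk Y M y m, hψ y m⟩
    · rintro _ _ ⟨s, rfl⟩ ⟨t, rfl⟩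
      exact ⟨s + t, map_add _ _ _⟩

theorem isRightExact_functor (Y : CovBimod H B A) : IsRightExact (functor Y) :=
  fun _ _ _ f g hex hg => exact_and_surjective (φ := FDMod.lin ((functor Y).map f))
    (ψ := FDMod.lin ((functor Y).map g)) hex hg (fun _ _ => rfl) (fun _ _ => rfl)

end RightExact

/-! ### The structure map of `Y ⊗_A -` is invertible, through `S⁻¹`. -/

section Lineator

variable {H B A : Type u} [Ring H] [HopfAlgebra ℂ H] [Ring A] [Algebra ℂ A]
  [Ring B] [Algebra ℂ B] [LeftComoduleAlgebra H A] [LeftComoduleAlgebra H B]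
  [FiniteDimensional ℂ H]

/-- `(h ⊗ y) ⊗ (x ⊗ m) ↦ y ⊗ (S⁻¹(h) x ⊗ m)`. -/
def unshuffle (Y : CovBimod H B A) (X : FDMod H) (M : FDMod A) :
    (H ⊗[ℂ] Y.carrier) ⊗[ℂ] (X.carrier ⊗[ℂ] M.carrier) →ₗ[ℂ] BalTensor Y (FDMod.tens X M) :=
  TensorProduct.lift (TensorProduct.lift (((LinearMap.llcomp ℂ (X.carrier ⊗[ℂ] M.carrier)
      (X.carrier ⊗[ℂ] M.carrier) (BalTensor Y (FDMod.tens X M))).flip ∘ₗ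
    LinearMap.rTensorHom M.carrier ∘ₗ X.act.toLinearMap ∘ₗ skewAntipode H).compl₂
      (mkTens Y X M)))

@[simp]
theorem unshuffle_tmul (Y : CovBimod H B A) (X : FDMod H) (M : FDMod A) (h : H) (y : Y.carrier)
    (x : X.carrier) (m : M.carrier) :
    unshuffle Y X M ((h ⊗ₜ[ℂ] y) ⊗ₜ[ℂ] (x ⊗ₜ[ℂ] m)) =
      mkTens Y X M y (X.act (skewAntipode H h) x ⊗ₜ[ℂ] m) := rfl

variable (H) in
/-- `h ⊗ k ↦ k S⁻¹(h)`. -/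
def mulSkew : H ⊗[ℂ] H →ₗ[ℂ] H :=
  TensorProduct.lift ((LinearMap.mul ℂ H).flip ∘ₗ skewAntipode H)

variable (H) in
/-- `h ⊗ k ↦ S⁻¹(k) h`. -/
def skewMul : H ⊗[ℂ] H →ₗ[ℂ] H :=
  TensorProduct.lift ((LinearMap.mul ℂ H).flip.compl₂ (skewAntipode H))

@[simp]
theorem mulSkew_tmul (h k : H) : mulSkew H (h ⊗ₜ[ℂ] k) = k * skewAntipode H h := rfl

@[simp]
theorem skewMul_tmul (h k : H) : skewMul H (h ⊗ₜ[ℂ] k) = skewAntipode H k * h := rfl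

/-- For `s = k ⊗ a`, moving `a` across `⊗_A` makes it act on `X ⊗ M` through its coaction, and
`S⁻¹(h k) = S⁻¹(k) S⁻¹(h)`. The factors `a₍₋₁₎ S⁻¹(k)` that meet are collected by `mulSkew`. -/
theorem unshuffle_extTensor (Y : CovBimod H B A) (X : FDMod H) (M : FDMod A) (s : H ⊗[ℂ] A)
    (h : H) (y : Y.carrier) (x : X.carrier) (m : M.carrier) :
    unshuffle Y X M (extTensor (rightMul H) Y.right (TensorProduct.map
        (MulOpposite.opLinearEquiv ℂ).toLinearMap (MulOpposite.opLinearEquiv ℂ).toLinearMap s)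
          (h ⊗ₜ[ℂ] y) ⊗ₜ[ℂ] (x ⊗ₜ[ℂ] m)) =
      mkTens Y X M y (extTensor X.act M.act (LinearMap.rTensor A (mulSkew H)
         ((TensorProduct.assoc ℂ H H A).symm (LinearMap.lTensor H
           (LeftComoduleAlgebra.coact (H := H)).toLinearMap s)))
        (X.act (skewAntipode H h) x ⊗ₜ[ℂ] m)) := by
  induction s with
  | zero => simp
  | add s s' hs hs' => simp only [map_add, LinearMap.add_apply, TensorProduct.add_tmul, hs, hs']
  | tmul k a =>
    simp only [TensorProduct.map_tmul, extTensor_tmul, LinearEquiv.coe_coe,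
      MulOpposite.coe_opLinearEquiv, unshuffle_tmul, mkTens_balanced, LinearMap.lTensor_tmul,
      AlgHom.toLinearMap_apply]
    congr 1
    induction LeftComoduleAlgebra.coact (H := H) a with
    | zero => simp
    | add s s' hs hs' => simp only [map_add, LinearMap.add_apply, TensorProduct.tmul_add, hs, hs']
    | tmul l a => simp [rightMul, skewAntipode_mul]

/-- This makes the inverse structure map well defined on `Y ⊗_A M`. After `unshuffle_extTensor` the
factor to simplify is `a₍₀₎₍₋₁₎ S⁻¹(a₍₋₁₎) ⊗ a₍₀₎₍₀₎`, which is `1 ⊗ a` by coassociativity and `∑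
h₍₂₎ S⁻¹(h₍₁₎) = ε(h)`. -/
theorem unshuffle_balanced (Y : CovBimod H B A) (X : FDMod H) (M : FDMod A) (a : A)
    (y : Y.carrier) (x : X.carrier) (m : M.carrier) :
    unshuffle Y X M (Y.coact (Y.right (MulOpposite.op a) y) ⊗ₜ[ℂ] (x ⊗ₜ[ℂ] m)) =
      unshuffle Y X M (Y.coact y ⊗ₜ[ℂ] (x ⊗ₜ[ℂ] M.act a m)) := by
  rw [Y.coact_right]
  induction Y.coact y with
  | zero => simp
  | add t t' ht ht' => simp only [map_add, TensorProduct.add_tmul, ht, ht']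
  | tmul h y =>
    refine (unshuffle_extTensor Y X M _ h y x m).trans ?_
    have h1 := rTensor_lTensor_coact (LeftComoduleAlgebra.coact (H := H) (A := A)).toLinearMap a
      (LeftComoduleAlgebra.coassoc a) (LeftComoduleAlgebra.counit a) (mulSkew H)
      mul_skewAntipode_comul
    have h2 := congrArg (fun w => mkTens Y X M y (extTensor X.act M.act w
      (X.act (skewAntipode H h) x ⊗ₜ[ℂ] m))) h1
    exact h2.trans (by simp)

/-- `y ⊗ m ↦ ∑ y₍₀₎ ⊗ (S⁻¹(y₍₋₁₎) x ⊗ m)`. -/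
def laxLinAux (Y : CovBimod H B A) (X : FDMod H) (M : FDMod A) (x : X.carrier) :
    BalTensor Y M →ₗ[ℂ] BalTensor Y (FDMod.tens X M) :=
  lift (M := M) (unshuffle Y X M ∘ₗ TensorProduct.map Y.coact (TensorProduct.mk ℂ X.carrier
    M.carrier x)) (fun y a m => unshuffle_balanced Y X M a y x m)

theorem laxLinAux_mk (Y : CovBimod H B A) (X : FDMod H) (M : FDMod A) (x : X.carrier)
    (y : Y.carrier) (m : M.carrier) :
    laxLinAux Y X M x (mk Y M y m) = unshuffle Y X M (Y.coact y ⊗ₜ[ℂ] (x ⊗ₜ[ℂ] m)) := rfl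

/-- `x ⊗ (y ⊗ m) ↦ ∑ y₍₀₎ ⊗ (S⁻¹(y₍₋₁₎) x ⊗ m)`. -/
def laxLin (Y : CovBimod H B A) (X : FDMod H) (M : FDMod A) :
    X.carrier ⊗[ℂ] BalTensor Y M →ₗ[ℂ] BalTensor Y (FDMod.tens X M) :=
  TensorProduct.lift
    { toFun := laxLinAux Y X M
      map_add' := fun x x' => by
        apply ext; intro y m
        simp only [LinearMap.add_apply, laxLinAux_mk, TensorProduct.add_tmul,
          TensorProduct.tmul_add, map_add]
      map_smul' := fun c x => by
        apply ext; intro y m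
        simp only [LinearMap.smul_apply, laxLinAux_mk, ← TensorProduct.smul_tmul',
          TensorProduct.tmul_smul, map_smul, RingHom.id_apply] }

theorem laxLin_tmul_mk (Y : CovBimod H B A) (X : FDMod H) (M : FDMod A) (x : X.carrier)
    (y : Y.carrier) (m : M.carrier) :
    laxLin Y X M (x ⊗ₜ[ℂ] mk Y M y m) = unshuffle Y X M (Y.coact y ⊗ₜ[ℂ] (x ⊗ₜ[ℂ] m)) := rfl

/-- Stated for an arbitrary tensor `t`, so that induction on `t` applies; at `t = Y.coact y` the
factor `S⁻¹(y₍₀₎₍₋₁₎) y₍₋₁₎` collapses by `rTensor_lTensor_coact`. `oplaxLin_unshuffle` plays the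
same role for the other composite, with `y₍₀₎₍₋₁₎ S⁻¹(y₍₋₁₎)`. -/
theorem laxLin_shuffle (Y : CovBimod H B A) (X : FDMod H) (M : FDMod A) (x : X.carrier)
    (m : M.carrier) (t : H ⊗[ℂ] Y.carrier) :
    laxLin Y X M (shuffle Y X.act M (t ⊗ₜ[ℂ] (x ⊗ₜ[ℂ] m))) =
      TensorProduct.lift ((mkTens Y X M).flip ∘ₗ (TensorProduct.mk ℂ X.carrier M.carrier).flip m ∘ₗ
        X.act.toLinearMap.flip x) (LinearMap.rTensor Y.carrier (skewMul H)
          ((TensorProduct.assoc ℂ H H Y.carrier).symm (LinearMap.lTensor H Y.coact t))) := by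
  induction t with
  | zero => simp
  | add t t' ht ht' => simp only [map_add, TensorProduct.add_tmul, ht, ht']
  | tmul h y =>
    rw [shuffle_tmul, laxLin_tmul_mk, LinearMap.lTensor_tmul]
    induction Y.coact y with
    | zero => simp
    | add s s' hs hs' => simp only [map_add, TensorProduct.add_tmul, TensorProduct.tmul_add, hs, hs']
    | tmul k y => simp

theorem oplaxLin_unshuffle (Y : CovBimod H B A) (X : FDMod H) (M : FDMod A) (x : X.carrier)
    (m : M.carrier) (t : H ⊗[ℂ] Y.carrier) :
    oplaxLin Y X M (unshuffle Y X M (t ⊗ₜ[ℂ] (x ⊗ₜ[ℂ] m))) =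
      TensorProduct.map (X.act.toLinearMap.flip x) ((mk Y M).flip m)
        (LinearMap.rTensor Y.carrier (mulSkew H)
          ((TensorProduct.assoc ℂ H H Y.carrier).symm (LinearMap.lTensor H Y.coact t))) := by
  induction t with
  | zero => simp
  | add t t' ht ht' => simp only [map_add, TensorProduct.add_tmul, ht, ht']
  | tmul h y =>
    rw [unshuffle_tmul, oplaxLin_mkTens, LinearMap.lTensor_tmul]
    induction Y.coact y with
    | zero => simp
    | add s s' hs hs' => simp only [map_add, TensorProduct.add_tmul, TensorProduct.tmul_add, hs, hs']
    | tmul k y => simp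

theorem laxLin_oplaxLin (Y : CovBimod H B A) (X : FDMod H) (M : FDMod A) :
    laxLin Y X M ∘ₗ oplaxLin Y X M = LinearMap.id := by
  apply ext_tens
  intro y x m
  rw [LinearMap.comp_apply, oplaxLin_mkTens, laxLin_shuffle,
    rTensor_lTensor_coact Y.coact y (Y.coassoc y) (Y.counit y) (skewMul H) skewAntipode_mul_comul]
  simp

theorem oplaxLin_laxLin (Y : CovBimod H B A) (X : FDMod H) (M : FDMod A) :
    oplaxLin Y X M ∘ₗ laxLin Y X M = LinearMap.id := by
  apply TensorProduct.ext'
  intro x t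
  refine induction (P := fun t => (oplaxLin Y X M ∘ₗ laxLin Y X M) (x ⊗ₜ[ℂ] t) =
    LinearMap.id (x ⊗ₜ[ℂ] t)) (by simp) ?_
    (fun s t hs ht => by simp only [TensorProduct.tmul_add, map_add, hs, ht]) t
  intro y m
  rw [LinearMap.comp_apply, laxLin_tmul_mk, oplaxLin_unshuffle,
    rTensor_lTensor_coact Y.coact y (Y.coassoc y) (Y.counit y) (mulSkew H) mul_skewAntipode_comul]
  simp

theorem isIso_oplaxHom (Y : CovBimod H B A) (X : FDMod H) (M : FDMod A) :
    IsIso (oplaxHom Y X M) := by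
  have h : IsIso (FDMod.isoOfLin (X := obj Y (FDMod.tens X M)) (Y := FDMod.tens X (obj Y M))
      (LinearEquiv.ofLinearMap (oplaxLin Y X M) (laxLin Y X M) (oplaxLin_laxLin Y X M)
        (laxLin_oplaxLin Y X M)) (FDMod.map_act (oplaxHom Y X M))).hom := inferInstance
  exact h

end Lineator

end BalTensor

theorem isRightExactModuleFunctor_tensorFunctor {H B A : Type u} [Ring H] [HopfAlgebra ℂ H]
    [FiniteDimensional ℂ H] [Ring A] [Algebra ℂ A] [Ring B] [Algebra ℂ B]
    [LeftComoduleAlgebra H A] [LeftComoduleAlgebra H B] (Y : CovBimod H B A) :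
    isRightExactModuleFunctor H A B ((tensorFunctor H B A).obj Y) :=
  ⟨⟨inferInstanceAs (BalTensor.functor Y).Additive, inferInstanceAs ((BalTensor.functor Y).Linear ℂ),
    BalTensor.isIso_oplaxHom Y⟩, BalTensor.isRightExact_functor Y⟩

/-! ### Free modules -/

namespace FDMod

theorem lin_sum {A : Type u} [Ring A] [Algebra ℂ A] {M N : FDMod A} {ι : Type*} (s : Finset ι)
    (f : ι → (M ⟶ N)) : lin (∑ i ∈ s, f i) = ∑ i ∈ s, lin (f i) :=
  map_sum (linAddHom M N) f s

section Free

variable (A : Type u) [Ring A] [Algebra ℂ A] [FiniteDimensional ℂ A]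

/-- The left regular module. -/
abbrev regular : FDMod A where
  carrier := A
  act := Algebra.lmul ℂ A

/-- The free module of rank `n`. -/
abbrev free (n : ℕ) : FDMod A where
  carrier := Fin n → A
  act := Algebra.lsmul ℂ ℂ (Fin n → A)

variable {A}

/-- The homomorphism `a ↦ a m` from the regular module. -/
def gen (M : FDMod A) (m : M.carrier) : regular A ⟶ M :=
  ofLin (X := regular A) (M.act.toLinearMap.flip m) (fun r x => by simp)

@[simp]
theorem lin_gen (M : FDMod A) (m : M.carrier) (a : A) : lin (gen M m) a = M.act a m := rfl

theorem regular_hom_ext {M : FDMod A} {f g : regular A ⟶ M}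
    (h : lin f (1 : A) = lin g (1 : A)) : f = g := by
  apply hom_ext
  apply LinearMap.ext
  intro a
  have h1 : ∀ f : regular A ⟶ M, lin f a = M.act a (lin f (1 : A)) := by
    intro f
    have := map_act f a (1 : A)
    simpa using this
  rw [h1, h1, h]

theorem lin_gen_one (M : FDMod A) (m : M.carrier) : lin (gen M m) (1 : A) = m := by
  rw [lin_gen, map_one, Module.End.one_apply]

theorem gen_comp {M N : FDMod A} (m : M.carrier) (f : M ⟶ N) :
    gen M m ≫ f = gen N (lin f m) := by
  apply regular_hom_ext
  rw [lin_comp, LinearMap.comp_apply, lin_gen_one, lin_gen_one]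

variable (A) in
theorem gen_regular_one : gen (regular A) (1 : A) = 𝟙 (regular A) :=
  regular_hom_ext (lin_gen_one (regular A) 1)

/-- `gen` as a linear map. -/
def genLin (M : FDMod A) : M.carrier →ₗ[ℂ] (regular A ⟶ M) where
  toFun := gen M
  map_add' m m' := by
    apply regular_hom_ext
    rw [lin_add, LinearMap.add_apply, lin_gen_one, lin_gen_one, lin_gen_one]
  map_smul' c m := by
    apply regular_hom_ext
    rw [RingHom.id_apply, lin_smul, LinearMap.smul_apply, lin_gen_one, lin_gen_one]

@[simp]
theorem genLin_apply (M : FDMod A) (m : M.carrier) : genLin M m = gen M m := rfl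

/-- Coordinates on a free module. -/
def freeProj {n : ℕ} (i : Fin n) : free A n ⟶ regular A :=
  ofLin (X := free A n) (Y := regular A) (LinearMap.proj i) (fun r x => by simp)

/-- The homomorphism from a free module given by a family of elements. -/
def freeDesc {n : ℕ} (M : FDMod A) (p : Fin n → M.carrier) : free A n ⟶ M :=
  ∑ i, freeProj i ≫ gen M (p i)

theorem lin_freeDesc {n : ℕ} (M : FDMod A) (p : Fin n → M.carrier) (v : Fin n → A) :
    lin (freeDesc M p) v = ∑ i, M.act (v i) (p i) := by
  rw [freeDesc, lin_sum, LinearMap.sum_apply]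
  rfl

theorem freeDesc_single (n : ℕ) :
    freeDesc (free A n) (fun i => (Pi.single i 1 : Fin n → A)) = 𝟙 (free A n) := by
  apply hom_ext
  apply LinearMap.ext
  intro v
  rw [lin_freeDesc]
  funext j
  simp [Finset.sum_apply, Pi.single_apply]

/-- A submodule that is stable under the action is the range of a homomorphism from a free module. -/
theorem exists_range_freeDesc_eq (M : FDMod A) (K : Submodule ℂ M.carrier)
    (hK : ∀ (a : A), ∀ m ∈ K, M.act a m ∈ K) :
    ∃ (n : ℕ) (p : Fin n → M.carrier), LinearMap.range (lin (freeDesc M p)) = K := by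
  obtain ⟨n, p, hp⟩ := Submodule.fg_iff_exists_fin_generating_family.1
    (IsNoetherian.noetherian K)
  refine ⟨n, p, le_antisymm ?_ ?_⟩
  · rintro _ ⟨v, rfl⟩
    rw [lin_freeDesc]
    exact Submodule.sum_mem _ fun i _ =>
      hK _ _ (hp ▸ Submodule.subset_span ⟨i, rfl⟩)
  · rw [← hp, Submodule.span_le]
    rintro _ ⟨i, rfl⟩
    refine ⟨(Pi.single i 1 : Fin n → A), ?_⟩
    rw [lin_freeDesc, Finset.sum_eq_single i]
    · simp
    · intro j _ hj
      simp [hj]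
    · simp

theorem exists_surjective_freeDesc (M : FDMod A) :
    ∃ (n : ℕ) (p : Fin n → M.carrier), Function.Surjective (lin (freeDesc M p)) := by
  obtain ⟨n, p, hp⟩ := exists_range_freeDesc_eq M ⊤ (by simp)
  exact ⟨n, p, LinearMap.range_eq_top.1 hp⟩

theorem exists_presentation (M : FDMod A) :
    ∃ (k n : ℕ) (f : free A k ⟶ free A n) (g : free A n ⟶ M),
      Function.Exact (lin f) (lin g) ∧ Function.Surjective (lin g) := by
  obtain ⟨n, p, hp⟩ := exists_surjective_freeDesc M
  -- The kernel of the cover is stable under the action, so it is again the image of a free module.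
  obtain ⟨k, q, hq⟩ := exists_range_freeDesc_eq (free A n) (LinearMap.ker (lin (freeDesc M p)))
    (fun a m hm => by
      rw [LinearMap.mem_ker] at hm ⊢
      rw [map_act, hm, map_zero])
  exact ⟨k, n, freeDesc _ q, freeDesc M p, LinearMap.exact_iff.2 hq.symm, hp⟩

/-- Every module over a semisimple algebra is a direct summand of a free module. -/
theorem exists_section_freeDesc [IsSemisimpleRing A] (M : FDMod A) :
    ∃ (n : ℕ) (p : Fin n → M.carrier) (s : M ⟶ free A n), s ≫ freeDesc M p = 𝟙 M := by
  obtain ⟨n, p, hp⟩ := exists_surjective_freeDesc M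
  let _ : Module A M.carrier := Module.compHom M.carrier M.act.toRingHom
  have hsmul : ∀ (a : A) (m : M.carrier), a • m = M.act a m := fun _ _ => rfl
  have : IsScalarTower ℂ A M.carrier := IsScalarTower.of_algebraMap_smul fun c m => by
    rw [hsmul]; simp [Module.algebraMap_end_apply]
  let g : (Fin n → A) →ₗ[A] M.carrier :=
    { toFun := lin (freeDesc M p)
      map_add' := map_add _
      map_smul' := fun a v => map_act (freeDesc M p) a v }
  -- Over a semisimple ring every module is projective, so the free cover splits.
  have := Module.projective_of_isSemisimpleRing A M.carrier
  obtain ⟨s, hs⟩ := Module.projective_lifting_property g LinearMap.id hp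
  refine ⟨n, p, ofLin (Y := free A n) (s.restrictScalars ℂ) (fun a m => s.map_smul a m), ?_⟩
  apply hom_ext
  apply LinearMap.ext
  intro m
  exact LinearMap.congr_fun hs m

end Free

/-! ### Extending invertibility from the regular module to all modules. -/

section Iso

variable {A : Type u} [Ring A] [Algebra ℂ A]

theorem isIso_of_bijective {M N : FDMod A} (f : M ⟶ N) (h : Function.Bijective (lin f)) :
    IsIso f := by
  have : IsIso (isoOfLin (LinearEquiv.ofBijective (lin f) h) (map_act f)).hom := inferInstance
  exact this

theorem bijective_of_isIso {M N : FDMod A} (f : M ⟶ N) [IsIso f] : Function.Bijective (lin f) := by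
  refine Function.bijective_iff_has_inverse.2 ⟨lin (inv f), fun x => ?_, fun x => ?_⟩
  · rw [← LinearMap.comp_apply, ← lin_comp, IsIso.hom_inv_id, lin_id, LinearMap.id_apply]
  · rw [← LinearMap.comp_apply, ← lin_comp, IsIso.inv_hom_id, lin_id, LinearMap.id_apply]

variable {B : Type u} [Ring B] [Algebra ℂ B] [FiniteDimensional ℂ A]
  {F G : FDMod A ⥤ FDMod B} (η : F ⟶ G)

/-- A natural transformation of additive functors that is invertible on the regular module is
invertible on direct summands of free modules. -/
theorem isIso_app_of_section [F.Additive] [G.Additive] [IsIso (η.app (regular A))] {M : FDMod A}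
    {n : ℕ} {p : Fin n → M.carrier} {s : M ⟶ free A n} (h : s ≫ freeDesc M p = 𝟙 M) :
    IsIso (η.app M) := by
  -- The identity of `M` is a sum of endomorphisms that factor through `A`. Additive functors
  -- preserve such a sum, and the inverse of `η` at `M` is assembled from its inverse at `A`, term
  -- by term.
  have h' : ∑ i, (s ≫ freeProj i) ≫ gen M (p i) = 𝟙 M := by
    rw [← h, freeDesc, Preadditive.comp_sum]
    simp
  refine ⟨∑ i, G.map (s ≫ freeProj i) ≫ inv (η.app (regular A)) ≫ F.map (gen M (p i)), ?_, ?_⟩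
  · rw [Preadditive.comp_sum, ← F.map_id, ← h', F.map_sum]
    refine Finset.sum_congr rfl fun i _ => ?_
    rw [← NatTrans.naturality_assoc, IsIso.hom_inv_id_assoc, ← F.map_comp]
  · rw [Preadditive.sum_comp, ← G.map_id, ← h', G.map_sum]
    refine Finset.sum_congr rfl fun i _ => ?_
    rw [Category.assoc, Category.assoc, NatTrans.naturality, IsIso.inv_hom_id_assoc, ← G.map_comp]

/-- A natural transformation of right exact functors that is invertible on the regular module is
invertible. -/
theorem isIso_app_of_isRightExact [F.Additive] [G.Additive] [IsIso (η.app (regular A))]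
    (hF : IsRightExact F) (hG : IsRightExact G) (M : FDMod A) : IsIso (η.app M) := by
  obtain ⟨k, n, f, g, hex, hg⟩ := exists_presentation M
  -- A free module is a summand of itself, with the identity as section.
  have hk : IsIso (η.app (free A k)) := isIso_app_of_section η
    ((Category.id_comp _).trans (freeDesc_single k))
  have hn : IsIso (η.app (free A n)) := isIso_app_of_section η
    ((Category.id_comp _).trans (freeDesc_single n))
  have bk := bijective_of_isIso (η.app (free A k))
  have bn := bijective_of_isIso (η.app (free A n))
  obtain ⟨hF1, hF2⟩ := hF _ _ _ f g hex hg
  obtain ⟨hG1, hG2⟩ := hG _ _ _ f g hex hg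
  have nf : ∀ x, lin (η.app (free A n)) (lin (F.map f) x) = lin (G.map f) (lin (η.app _) x) :=
    fun x => LinearMap.congr_fun (congrArg lin (η.naturality f)) x
  have ng : ∀ x, lin (η.app M) (lin (F.map g) x) = lin (G.map g) (lin (η.app _) x) :=
    fun x => LinearMap.congr_fun (congrArg lin (η.naturality g)) x
  apply isIso_of_bijective
  -- Five lemma for the right exact rows over `A^k → A^n → M → 0`, by diagram chase.
  constructor
  · rw [injective_iff_map_eq_zero]
    intro t ht
    obtain ⟨t, rfl⟩ := hF2 t
    rw [ng] at ht
    obtain ⟨q, hq⟩ := (hG1 _).1 ht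
    obtain ⟨q, rfl⟩ := bk.2 q
    rw [← nf] at hq
    exact (hF1 _).2 ⟨q, bn.1 hq⟩
  · intro z
    obtain ⟨z, rfl⟩ := hG2 z
    obtain ⟨z, rfl⟩ := bn.2 z
    exact ⟨lin (F.map g) z, ng z⟩

end Iso

end FDMod

/-! ### The covariant bimodule of a module functor -/

section Reconstruction

open FDMod
open Functor.OplaxLeftLinear
open scoped MonoidalLeftAction

/-! ### The coaction of `A` as a module homomorphism determined by `1 ↦ 1 ⊗ 1`. -/

section CoactHom

variable (H A : Type u) [Ring H] [Bialgebra ℂ H] [Ring A] [Algebra ℂ A] [LeftComoduleAlgebra H A]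

variable {H A} in
/-- The element `x ⊗ m` of `X ⊗ M`. -/
def tmul (X : FDMod H) (M : FDMod A) (x : X.carrier) (m : M.carrier) : (tens X M).carrier :=
  (x ⊗ₜ[ℂ] m : X.carrier ⊗[ℂ] M.carrier)

variable {H A} in
theorem lin_tensMap_tmul {X X' : FDMod H} {M M' : FDMod A} (f : X ⟶ X') (g : M ⟶ M')
    (x : X.carrier) (m : M.carrier) :
    lin (tensMap f g) (tmul X M x m) = tmul X' M' (lin f x) (lin g m) := rfl

variable [FiniteDimensional ℂ H] [FiniteDimensional ℂ A]

/-- The coaction of a comodule algebra, as a module homomorphism `A ⟶ H ⊗ A`. -/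
def coactHom : regular A ⟶ tens (regular H) (regular A) :=
  gen (tens (regular H) (regular A)) (tmul (regular H) (regular A) (1 : H) (1 : A))

theorem lin_coactHom_one :
    lin (coactHom H A) (1 : A) = tmul (regular H) (regular A) (1 : H) (1 : A) :=
  lin_gen_one _ _

/-- An element `a` acts on `H ⊗ A` as left multiplication by its coaction, so applied to `1 ⊗ 1` it
returns that coaction. -/
theorem lin_coactHom :
    lin (coactHom H A) = (LeftComoduleAlgebra.coact (H := H) (A := A)).toLinearMap := by
  have h : ∀ t : H ⊗[ℂ] A, extTensor (Algebra.lmul ℂ H) (Algebra.lmul ℂ A) t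
      ((1 : H) ⊗ₜ[ℂ] (1 : A)) = t := by
    intro t
    induction t with
    | zero => simp
    | add s t hs ht => simp only [map_add, LinearMap.add_apply, hs, ht]
    | tmul k y => simp
  exact LinearMap.ext fun a => h _

-- Both sides send `1` to `x ⊗ m`. With naturality, this reduces every structure morphism of a
-- module functor to the one at the pair `(H, A)`.
variable {H A} in
theorem coactHom_tensMap (X : FDMod H) (M : FDMod A) (x : X.carrier) (m : M.carrier) :
    coactHom H A ≫ tensMap (gen X x) (gen M m) = gen (tens X M) (tmul X M x m) := by
  rw [coactHom, gen_comp, lin_tensMap_tmul, lin_gen_one, lin_gen_one]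

/-- The comultiplication as a module homomorphism. -/
abbrev comulHom : regular H ⟶ tens (regular H) (regular H) := coactHom H H

/-- The counit as a module homomorphism. -/
def counitHom : regular H ⟶ triv H := gen (triv H) (ULift.up (1 : ℂ))

theorem lin_counitHom (h : H) :
    lin (counitHom H) h = ULift.up (Coalgebra.counit (R := ℂ) h) := by
  refine (trivAct_apply h (ULift.up (1 : ℂ))).trans ?_
  apply ULift.ext
  simp

/-- Homomorphisms out of `A` are determined by the image of `1`, here `1 ⊗ (1 ⊗ 1)` on both sides.
-/
theorem coactHom_coassoc :
    coactHom H A ≫ tensMap (comulHom H) (𝟙 _) ≫ (tensAssoc _ _ _).hom =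
      coactHom H A ≫ tensMap (𝟙 _) (coactHom H A) := by
  rw [coactHom, gen_comp, gen_comp, lin_comp, LinearMap.comp_apply, lin_tensMap_tmul,
    lin_tensMap_tmul, ← coactHom, lin_coactHom_one, lin_coactHom_one]
  rfl

theorem coactHom_counit :
    coactHom H A ≫ tensMap (counitHom H) (𝟙 _) ≫ (tensLeftUnitor _).hom = 𝟙 _ := by
  refine Eq.trans ?_ (gen_regular_one A)
  rw [coactHom, gen_comp, lin_comp, LinearMap.comp_apply, lin_tensMap_tmul, lin_counitHom]
  congr 1
  change (Coalgebra.counit (R := ℂ) (1 : H)) • (1 : A) = 1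
  simp

end CoactHom

variable {H A B : Type u} [Ring H] [Bialgebra ℂ H] [Ring A] [Algebra ℂ A] [Ring B] [Algebra ℂ B]
  [LeftComoduleAlgebra H A] [LeftComoduleAlgebra H B]

/-- Every element of `Y ⊗_A A` is of the form `y ⊗ 1`. -/
theorem BalTensor.exists_mk_one [FiniteDimensional ℂ A] {Y : CovBimod H B A}
    (t : BalTensor Y (regular A)) :
    ∃ y, mk Y (regular A) y (1 : A) = t := by
  refine BalTensor.induction (P := fun t => ∃ y, mk Y (regular A) y (1 : A) = t) ⟨0, ?_⟩ ?_ ?_ t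
  · rw [map_zero, LinearMap.zero_apply]
  · intro y a
    refine ⟨Y.right (MulOpposite.op a) y, ?_⟩
    rw [mk_balanced]
    exact congrArg (mk Y (regular A) y) (mul_one a)
  · rintro _ _ ⟨y, rfl⟩ ⟨z, rfl⟩
    exact ⟨y + z, by rw [map_add, LinearMap.add_apply]⟩

namespace OplaxModuleFunctor

/-- A morphism of module functors is invertible if its components are. -/
theorem isIso_of_isIso_app {F G : OplaxModuleFunctor H A B} (α : F ⟶ G)
    (h : ∀ M, IsIso (Hom.nat α |>.app M)) : IsIso α := by
  have hn : IsIso (Hom.nat α) := NatIso.isIso_of_isIso_app _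
  refine ⟨⟨inv (Hom.nat α), fun X M => ?_⟩, ?_, ?_⟩
  · have h1 := Hom.comm α X M
    have h2 : IsIso ((Hom.nat α).app (X ⊙ₗ M)) := h _
    -- Compatibility of the inverse is the compatibility of `α`, once the invertible component at `X
    -- ⊗ M` is cancelled.
    rw [← cancel_epi ((Hom.nat α).app (X ⊙ₗ M)), ← reassoc_of% h1]
    simp [← MonoidalLeftAction.actionHomRight_comp]
  · exact Hom.ext (IsIso.hom_inv_id (Hom.nat α))
  · exact Hom.ext (IsIso.inv_hom_id (Hom.nat α))

variable (F : OplaxModuleFunctor H A B)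

/-- The structure morphism `F (X ⊗ M) ⟶ X ⊗ F M`. -/
def str (X : FDMod H) (M : FDMod A) :
    F.toFunctor.obj (tens X M) ⟶ tens X (F.toFunctor.obj M) :=
  δₗ F.toFunctor X M

theorem str_naturality {X X' : FDMod H} {M M' : FDMod A} (f : X ⟶ X') (g : M ⟶ M') :
    F.toFunctor.map (tensMap f g) ≫ F.str X' M' = F.str X M ≫ tensMap f (F.toFunctor.map g) := by
  have h1 := δₗ_naturality_left F.toFunctor f M
  have h2 := δₗ_naturality_right F.toFunctor X' g
  have h3 : tensMap f g = f ⊵ₗ M ≫ X' ⊴ₗ g := MonoidalLeftAction.actionHom_def f g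
  have h4 : tensMap f (F.toFunctor.map g) = f ⊵ₗ _ ≫ X' ⊴ₗ (F.toFunctor.map g) :=
    MonoidalLeftAction.actionHom_def f (F.toFunctor.map g)
  rw [h3, h4, Functor.map_comp]
  change _ ≫ δₗ F.toFunctor X' M' = δₗ F.toFunctor X M ≫ _
  rw [Category.assoc, h2, reassoc_of% h1]

theorem str_assoc (X X' : FDMod H) (M : FDMod A) :
    F.str (tens X X') M ≫ (tensAssoc X X' (F.toFunctor.obj M)).hom =
      F.toFunctor.map (tensAssoc X X' M).hom ≫ F.str X (tens X' M) ≫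
        tensMap (𝟙 X) (F.str X' M) :=
  δₗ_associativity F.toFunctor X X' M

theorem str_unit (M : FDMod A) :
    F.str (triv H) M ≫ (tensLeftUnitor (F.toFunctor.obj M)).hom =
      F.toFunctor.map (tensLeftUnitor M).hom :=
  δₗ_unitality_hom F.toFunctor (C := FDMod H) M

/-! ### The right action of `A` on `F A` by functoriality. -/

section MapGen

variable [FiniteDimensional ℂ A] [F.toFunctor.Additive] [F.toFunctor.Linear ℂ]

/-- `m ↦ F(a ↦ a m)`. -/
def mapGen (M : FDMod A) : M.carrier →ₗ[ℂ]
    (F.toFunctor.obj (regular A)).carrier →ₗ[ℂ] (F.toFunctor.obj M).carrier where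
  toFun m := lin (F.toFunctor.map (gen M m))
  map_add' m m' := by
    rw [← genLin_apply, map_add, Functor.map_add, lin_add]; rfl
  map_smul' c m := by
    rw [← genLin_apply, map_smul, Functor.map_smul, lin_smul]; rfl

theorem mapGen_naturality {M N : FDMod A} (f : M ⟶ N) (m : M.carrier)
    (y : (F.toFunctor.obj (regular A)).carrier) :
    F.mapGen N (lin f m) y = lin (F.toFunctor.map f) (F.mapGen M m y) := by
  change lin (F.toFunctor.map (gen N (lin f m))) y = _
  rw [← gen_comp, Functor.map_comp]
  rfl

/-- The map `x ↦ x a m` is right multiplication by `a` followed by `x ↦ x m`. This gives both the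
multiplicativity of `rightAct` and the balancedness of `evalLin`. -/
theorem mapGen_act (M : FDMod A) (a : A) (m : M.carrier)
    (y : (F.toFunctor.obj (regular A)).carrier) :
    F.mapGen M (M.act a m) y = F.mapGen M m (F.mapGen (regular A) a y) := by
  rw [← lin_gen, mapGen_naturality]
  rfl

theorem mapGen_map_act (M : FDMod A) (b : B) (m : M.carrier)
    (y : (F.toFunctor.obj (regular A)).carrier) :
    F.mapGen M m ((F.toFunctor.obj (regular A)).act b y) =
      (F.toFunctor.obj M).act b (F.mapGen M m y) :=
  FDMod.map_act _ _ _

theorem mapGen_one (y : (F.toFunctor.obj (regular A)).carrier) :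
    F.mapGen (regular A) (1 : A) y = y := by
  change lin (F.toFunctor.map (gen (regular A) (1 : A))) y = y
  rw [gen_regular_one, F.toFunctor.map_id]
  rfl

/-- The right action of `A` on `F A`. -/
def rightAct : Aᵐᵒᵖ →ₐ[ℂ] Module.End ℂ (F.toFunctor.obj (regular A)).carrier :=
  AlgHom.ofLinearMap (F.mapGen (regular A) ∘ₗ (MulOpposite.opLinearEquiv ℂ).symm.toLinearMap)
    (by ext y; exact F.mapGen_one y)
    (fun a b => by ext y; exact F.mapGen_act (regular A) b.unop a.unop y)

theorem rightAct_op (a : A) (y : (F.toFunctor.obj (regular A)).carrier) :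
    F.rightAct (MulOpposite.op a) y = F.mapGen (regular A) a y := rfl

end MapGen

variable [FiniteDimensional ℂ H] [FiniteDimensional ℂ A]

/-- The coaction on `F A`, as a module homomorphism. -/
def coactNat : F.toFunctor.obj (regular A) ⟶ tens (regular H) (F.toFunctor.obj (regular A)) :=
  F.toFunctor.map (coactHom H A) ≫ F.str (regular H) (regular A)

/-- Naturality moves the comultiplication and the second coaction inside `F`. The associativity
axiom of `F` then leaves the image under `F` of `coactHom_coassoc`. -/
theorem coactNat_coassoc :
    F.coactNat ≫ tensMap (comulHom H) (𝟙 _) ≫ (tensAssoc _ _ _).hom =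
      F.coactNat ≫ tensMap (𝟙 _) F.coactNat := by
  have h1 := F.str_naturality (comulHom H) (𝟙 (regular A))
  have h2 := F.str_naturality (𝟙 (regular H)) (coactHom H A)
  have h4 : tensMap (𝟙 (regular H)) F.coactNat =
      tensMap (𝟙 _) (F.toFunctor.map (coactHom H A)) ≫
        tensMap (𝟙 _) (F.str (regular H) (regular A)) :=
    MonoidalLeftAction.actionHomRight_comp (regular H) (F.toFunctor.map (coactHom H A))
      (F.str (regular H) (regular A))
  rw [F.toFunctor.map_id] at h1
  rw [h4, coactNat, Category.assoc, ← reassoc_of% h1, F.str_assoc, Category.assoc,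
    ← reassoc_of% h2]
  simp only [← Functor.map_comp_assoc]
  rw [← coactHom_coassoc]

theorem coactNat_counit :
    F.coactNat ≫ tensMap (counitHom H) (𝟙 _) ≫ (tensLeftUnitor _).hom = 𝟙 _ := by
  have h1 := F.str_naturality (counitHom H) (𝟙 (regular A))
  rw [F.toFunctor.map_id] at h1
  rw [coactNat, Category.assoc, ← reassoc_of% h1, F.str_unit, ← Functor.map_comp,
    ← Functor.map_comp, coactHom_counit, F.toFunctor.map_id]

/-- The structure morphism, evaluated on the image of an element of `F A`. -/
theorem str_gen (X : FDMod H) (M : FDMod A) (x : X.carrier) (m : M.carrier) :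
    F.toFunctor.map (gen (tens X M) (tmul X M x m)) ≫ F.str X M =
      F.coactNat ≫ tensMap (gen X x) (F.toFunctor.map (gen M m)) := by
  rw [← coactHom_tensMap, Functor.map_comp, Category.assoc, F.str_naturality, coactNat,
    Category.assoc]

/-- The coaction on `F A`. -/
def coactLin : (F.toFunctor.obj (regular A)).carrier →ₗ[ℂ]
    H ⊗[ℂ] (F.toFunctor.obj (regular A)).carrier :=
  lin F.coactNat

theorem lin_str_gen (X : FDMod H) (M : FDMod A) (x : X.carrier) (m : M.carrier)
    (y : (F.toFunctor.obj (regular A)).carrier) :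
    lin (F.str X M) (lin (F.toFunctor.map
        (gen (tens X M) (tmul X M x m))) y) =
      TensorProduct.map (X.act.toLinearMap.flip x) (lin (F.toFunctor.map (gen M m)))
        (F.coactLin y) :=
  LinearMap.congr_fun (congrArg lin (F.str_gen X M x m)) y

variable [F.toFunctor.Additive] [F.toFunctor.Linear ℂ]

/-- On a pure tensor `h ⊗ a` this is `lin_str_gen` at `(H, A)`: `gen h` is right multiplication by
`h`, and `F (gen a)` is the right action of `a`. At `s = coact a` it becomes the right covariance of
`F A`. -/
theorem lin_str_mapGen (s : H ⊗[ℂ] A) (y : (F.toFunctor.obj (regular A)).carrier) :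
    lin (F.str (regular H) (regular A)) (F.mapGen (tens (regular H) (regular A)) s y) =
      extTensor (rightMul H) F.rightAct (TensorProduct.map
        (MulOpposite.opLinearEquiv ℂ).toLinearMap (MulOpposite.opLinearEquiv ℂ).toLinearMap s)
          (F.coactLin y) := by
  induction s with
  | zero =>
    rw [map_zero, map_zero]
    exact (congrArg (fun z => lin (F.str (regular H) (regular A)) z)
      (LinearMap.congr_fun (map_zero (F.mapGen (tens (regular H) (regular A)))) y)).trans
        (map_zero _)
  | add s t hs ht =>
    rw [map_add, map_add, LinearMap.add_apply, ← hs, ← ht]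
    exact (congrArg (fun z => lin (F.str (regular H) (regular A)) z)
      (LinearMap.congr_fun (map_add (F.mapGen (tens (regular H) (regular A))) s t) y)).trans
        (map_add _ _ _)
  | tmul h a =>
    have h1 : TensorProduct.map ((Algebra.lmul ℂ H).toLinearMap.flip h) (F.mapGen (regular A) a) =
        extTensor (rightMul H) F.rightAct (MulOpposite.op h ⊗ₜ[ℂ] MulOpposite.op a) :=
      TensorProduct.ext' fun k y => rfl
    exact (F.lin_str_gen (regular H) (regular A) h a y).trans (LinearMap.congr_fun h1 _)

/-- The covariant bimodule `F A` of a module functor `F`. -/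
def bimod : CovBimod H B A where
  carrier := (F.toFunctor.obj (regular A)).carrier
  left := (F.toFunctor.obj (regular A)).act
  right := F.rightAct
  left_right b a y := (F.mapGen_map_act (regular A) b a y).symm
  coact := F.coactLin
  coassoc y := by
    have h : TensorProduct.assoc ℂ H H _ (TensorProduct.map (lin (comulHom H)) LinearMap.id
        (F.coactLin y)) = LinearMap.lTensor H F.coactLin (F.coactLin y) :=
      LinearMap.congr_fun (congrArg lin F.coactNat_coassoc) y
    rw [lin_coactHom] at h
    exact h
  counit y := by
    have h : trivTensor _ (TensorProduct.map (lin (counitHom H)) LinearMap.id (F.coactLin y)) = y :=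
      LinearMap.congr_fun (congrArg lin F.coactNat_counit) y
    have h1 : (TensorProduct.lid ℂ (F.toFunctor.obj (regular A)).carrier).toLinearMap ∘ₗ
        LinearMap.rTensor _ (Coalgebra.counit : H →ₗ[ℂ] ℂ) =
        (trivTensor _).toLinearMap ∘ₗ TensorProduct.map (lin (counitHom H)) LinearMap.id :=
      TensorProduct.ext' fun k y => by
        change Coalgebra.counit (R := ℂ) k • y = (lin (counitHom H) k).down • y
        rw [lin_counitHom]
    exact (LinearMap.congr_fun h1 _).trans h
  coact_left b y := FDMod.map_act F.coactNat b y
  coact_right a y := by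
    refine Eq.trans ?_ (F.lin_str_mapGen (LeftComoduleAlgebra.coact (H := H) a) y)
    refine congrArg (lin (F.str (regular H) (regular A))) ?_
    rw [rightAct_op]
    -- Naturality replaces `F(coactHom)` applied to `y a` by `F` of the homomorphism `A ⟶ H ⊗ A`
    -- that sends `1` to the coaction of `a`.
    refine (F.mapGen_naturality (coactHom H A) a y).symm.trans ?_
    refine congrArg (fun m => F.mapGen (tens (regular H) (regular A)) m y) ?_
    exact LinearMap.congr_fun (lin_coactHom H A) a

/-- The linear map `F A ⊗_A M → F M`, `y ⊗ m ↦ F(a ↦ a m) y`. -/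
def evalLin (M : FDMod A) : BalTensor F.bimod M →ₗ[ℂ] (F.toFunctor.obj M).carrier :=
  BalTensor.lift (Y := F.bimod) (M := M) (TensorProduct.lift (F.mapGen M).flip)
    (fun y a m => (F.mapGen_act M a m y).symm)

/-- The homomorphism `F A ⊗_A M ⟶ F M`, `y ⊗ m ↦ F(a ↦ a m) y`. -/
def evalHom (M : FDMod A) : BalTensor.obj F.bimod M ⟶ F.toFunctor.obj M :=
  ofLin (X := BalTensor.obj F.bimod M) (F.evalLin M) (fun b t => by
    have h : F.evalLin M ∘ₗ BalTensor.act F.bimod M b =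
        (F.toFunctor.obj M).act b ∘ₗ F.evalLin M :=
      BalTensor.ext fun y m => F.mapGen_map_act M b m y
    exact LinearMap.congr_fun h t)

/-- Every element of `F A ⊗_A A` has the form `y ⊗ 1`, and evaluation sends it to `y`. -/
theorem bijective_evalHom_regular : Function.Bijective (lin (F.evalHom (regular A))) := by
  have h : ∀ y, lin (F.evalHom (regular A)) (BalTensor.mk F.bimod (regular A) y (1 : A)) = y :=
    fun y => F.mapGen_one y
  constructor
  · intro s t hst
    obtain ⟨y, rfl⟩ := BalTensor.exists_mk_one s
    obtain ⟨z, rfl⟩ := BalTensor.exists_mk_one t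
    rw [h, h] at hst
    rw [hst]
  · intro y
    exact ⟨_, h y⟩

/-- The morphism of module functors `F A ⊗_A - ⟶ F`. -/
def eval : (tensorFunctor H B A).obj F.bimod ⟶ F where
  nat :=
    { app := F.evalHom
      naturality := fun M N f => by
        apply FDMod.hom_ext
        apply BalTensor.ext
        intro y m
        exact F.mapGen_naturality f m y }
  comm X M := by
    apply FDMod.hom_ext
    refine BalTensor.ext_tens (Y := F.bimod) (X := X) (M := M) ?_
    intro y x m
    -- `lin_str_gen` expresses the structure map of `F` through the coaction on `F A`, which is how
    -- the structure map of `F A ⊗_A -` is defined.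
    refine Eq.trans ?_ (F.lin_str_gen X M x m y).symm
    have h : TensorProduct.map LinearMap.id (F.evalLin M) ∘ₗ BalTensor.shuffle F.bimod X.act M ∘ₗ
        (TensorProduct.mk ℂ _ _).flip (x ⊗ₜ[ℂ] m) =
        TensorProduct.map (X.act.toLinearMap.flip x) (F.mapGen M m) :=
      TensorProduct.ext' fun k y => rfl
    exact LinearMap.congr_fun h (F.coactLin y)

end OplaxModuleFunctor

end Reconstruction

/-! ### The functor `Y ↦ Y ⊗_A -` is an equivalence -/

section Equivalence

open FDMod
open Functor.OplaxLeftLinear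
open scoped MonoidalLeftAction

/-! ### Full faithfulness, by evaluation at the regular module. -/

section FullyFaithful

variable {H A B : Type u} [Ring H] [Bialgebra ℂ H] [Ring A] [Algebra ℂ A] [Ring B] [Algebra ℂ B]
  [LeftComoduleAlgebra H A] [LeftComoduleAlgebra H B] [FiniteDimensional ℂ A]

/-- `y ⊗ a ↦ y a`. -/
def BalTensor.contract (Y : CovBimod H B A) : BalTensor Y (regular A) →ₗ[ℂ] Y.carrier :=
  lift (M := regular A)
    (TensorProduct.lift (Y.right.toLinearMap ∘ₗ (MulOpposite.opLinearEquiv ℂ).toLinearMap).flip)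
    (fun y a x => by
      change Y.right (MulOpposite.op x) (Y.right (MulOpposite.op a) y) =
        Y.right (MulOpposite.op (a * x)) y
      rw [MulOpposite.op_mul, map_mul, Module.End.mul_apply])

theorem BalTensor.contract_mk (Y : CovBimod H B A) (y : Y.carrier) (a : A) :
    contract Y (mk Y (regular A) y a) = Y.right (MulOpposite.op a) y := rfl

theorem BalTensor.contract_mk_one (Y : CovBimod H B A) (y : Y.carrier) :
    contract Y (mk Y (regular A) y (1 : A)) = y := by
  rw [contract_mk, MulOpposite.op_one, map_one, Module.End.one_apply]

instance : (tensorFunctor H B A).Faithful where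
  map_injective {Y Z f g} h := by
    apply CovBimod.Hom.ext
    apply LinearMap.ext
    intro y
    have h1 : BalTensor.mk Z (regular A) (CovBimod.Hom.lin f y) (1 : A) =
        BalTensor.mk Z (regular A) (CovBimod.Hom.lin g y) (1 : A) :=
      congrArg (fun α : (tensorFunctor H B A).obj Y ⟶ (tensorFunctor H B A).obj Z =>
        lin ((OplaxModuleFunctor.Hom.nat α).app (regular A)) (BalTensor.mk Y _ y (1 : A))) h
    rw [← BalTensor.contract_mk_one Z (CovBimod.Hom.lin f y), h1, BalTensor.contract_mk_one]

variable {Y Z : CovBimod H B A} (α : (tensorFunctor H B A).obj Y ⟶ (tensorFunctor H B A).obj Z)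

/-- The components of a natural transformation `Y ⊗_A - ⟶ Z ⊗_A -`, as linear maps. -/
def appLin (M : FDMod A) : BalTensor Y M →ₗ[ℂ] BalTensor Z M :=
  lin ((OplaxModuleFunctor.Hom.nat α).app M)

/-- The linear map `Y → Z` induced by a natural transformation `Y ⊗_A - ⟶ Z ⊗_A -`. -/
def preimageLin : Y.carrier →ₗ[ℂ] Z.carrier :=
  BalTensor.contract Z ∘ₗ appLin α (regular A) ∘ₗ (BalTensor.mk Y (regular A)).flip (1 : A)

theorem appLin_mk_one (y : Y.carrier) :
    appLin α (regular A) (BalTensor.mk Y (regular A) y (1 : A)) =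
      BalTensor.mk Z (regular A) (preimageLin α y) (1 : A) := by
  obtain ⟨z, hz⟩ := BalTensor.exists_mk_one
    (appLin α (regular A) (BalTensor.mk Y (regular A) y (1 : A)))
  have : preimageLin α y = z := by
    change BalTensor.contract Z (appLin α (regular A) _) = z
    rw [LinearMap.flip_apply, ← hz, BalTensor.contract_mk_one]
  rw [this, hz]

/-- Naturality along `A ⟶ M`, `1 ↦ m`, carries the value at `y ⊗ 1` to the value at `y ⊗ m`. -/
theorem appLin_mk (M : FDMod A) (y : Y.carrier) (m : M.carrier) :
    appLin α M (BalTensor.mk Y M y m) = BalTensor.mk Z M (preimageLin α y) m := by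
  have h : appLin α M (BalTensor.mk Y M y (lin (gen M m) (1 : A))) =
      lin ((BalTensor.functor Z).map (gen M m))
        (appLin α (regular A) (BalTensor.mk Y (regular A) y (1 : A))) :=
    LinearMap.congr_fun (congrArg lin ((OplaxModuleFunctor.Hom.nat α).naturality (gen M m)))
      (BalTensor.mk Y (regular A) y (1 : A))
  rw [appLin_mk_one, lin_gen_one] at h
  refine h.trans ?_
  change BalTensor.mk Z M (preimageLin α y) (lin (gen M m) (1 : A)) = _
  rw [lin_gen_one]

variable [FiniteDimensional ℂ H]

/-- Compatibility of `α` with the structure maps is used at the single element `y ⊗ (1 ⊗ 1)` of `Y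
⊗_A (H ⊗ A)`. The structure map sends it to `y₍₋₁₎ ⊗ (y₍₀₎ ⊗ 1)`, and contraction recovers the
coaction. -/
theorem lTensor_preimageLin_coact (y : Y.carrier) :
    LinearMap.lTensor H (preimageLin α) (Y.coact y) = Z.coact (preimageLin α y) := by
  have h : TensorProduct.map LinearMap.id (appLin α (regular A))
      (BalTensor.shuffle Y (regular H).act (regular A) (Y.coact y ⊗ₜ[ℂ] ((1 : H) ⊗ₜ[ℂ] (1 : A)))) =
      BalTensor.oplaxLin Z (regular H) (regular A) (appLin α (tens (regular H) (regular A))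
        (BalTensor.mkTens Y (regular H) (regular A) y ((1 : H) ⊗ₜ[ℂ] (1 : A)))) :=
    LinearMap.congr_fun (congrArg lin (OplaxModuleFunctor.Hom.comm α (regular H) (regular A)))
      (BalTensor.mkTens Y (regular H) (regular A) y ((1 : H) ⊗ₜ[ℂ] (1 : A)))
  have h1 : appLin α (tens (regular H) (regular A))
        (BalTensor.mkTens Y (regular H) (regular A) y ((1 : H) ⊗ₜ[ℂ] (1 : A))) =
      BalTensor.mkTens Z (regular H) (regular A) (preimageLin α y) ((1 : H) ⊗ₜ[ℂ] (1 : A)) :=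
    appLin_mk α (tens (regular H) (regular A)) y (tmul (regular H) (regular A) (1 : H) (1 : A))
  have h2 : ∀ W : CovBimod H B A, TensorProduct.map LinearMap.id (BalTensor.contract W) ∘ₗ
      BalTensor.shuffle W (Algebra.lmul ℂ H) (regular A) ∘ₗ
        (TensorProduct.mk ℂ _ _).flip ((1 : H) ⊗ₜ[ℂ] (1 : A)) = LinearMap.id := fun W =>
    TensorProduct.ext' fun k w => by
      change (k * 1) ⊗ₜ[ℂ] BalTensor.contract W (BalTensor.mk W (regular A) w (1 : A)) = k ⊗ₜ[ℂ] w
      rw [mul_one, BalTensor.contract_mk_one]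
  have h3 : TensorProduct.map LinearMap.id (BalTensor.contract Z) ∘ₗ
      TensorProduct.map LinearMap.id (appLin α (regular A)) ∘ₗ
      BalTensor.shuffle Y (Algebra.lmul ℂ H) (regular A) ∘ₗ
        (TensorProduct.mk ℂ _ _).flip ((1 : H) ⊗ₜ[ℂ] (1 : A)) =
      LinearMap.lTensor H (preimageLin α) :=
    TensorProduct.ext' fun k w => by
      change (k * 1) ⊗ₜ[ℂ] preimageLin α w = k ⊗ₜ[ℂ] preimageLin α w
      rw [mul_one]
  rw [h1, BalTensor.oplaxLin_mkTens] at h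
  have h4 := congrArg (TensorProduct.map LinearMap.id (BalTensor.contract Z)) h
  exact (LinearMap.congr_fun h3 _).symm.trans (h4.trans (LinearMap.congr_fun (h2 Z) _))

/-- The morphism `Y ⟶ Z` induced by a morphism of module functors `Y ⊗_A - ⟶ Z ⊗_A -`. -/
def preimageHom : Y ⟶ Z where
  lin := preimageLin α
  map_left b y := by
    have h : appLin α (regular A) (BalTensor.mk Y (regular A) (Y.left b y) (1 : A)) =
        BalTensor.act Z (regular A) b
          (appLin α (regular A) (BalTensor.mk Y (regular A) y (1 : A))) :=
      FDMod.map_act ((OplaxModuleFunctor.Hom.nat α).app (regular A)) b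
        (BalTensor.mk Y (regular A) y (1 : A))
    rw [appLin_mk_one, appLin_mk_one, BalTensor.act_mk] at h
    rw [← BalTensor.contract_mk_one Z (preimageLin α (Y.left b y)), h, BalTensor.contract_mk_one]
  map_right a y := by
    -- Here `y a ⊗ 1 = y ⊗ a`, so right linearity follows from the formula for `α` on pure tensors.
    have h : appLin α (regular A) (BalTensor.mk Y (regular A) (Y.right (MulOpposite.op a) y)
        (1 : A)) = BalTensor.mk Z (regular A) (preimageLin α y) a := by
      rw [BalTensor.mk_balanced, appLin_mk]
      exact congrArg (BalTensor.mk Z (regular A) (preimageLin α y)) (mul_one a)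
    rw [appLin_mk_one] at h
    rw [← BalTensor.contract_mk_one Z (preimageLin α (Y.right _ y)), h, BalTensor.contract_mk]
  map_coact := lTensor_preimageLin_coact α

instance : (tensorFunctor H B A).Full where
  map_surjective α := ⟨preimageHom α, by
    apply OplaxModuleFunctor.Hom.ext
    apply NatTrans.ext
    funext M
    apply FDMod.hom_ext
    apply BalTensor.ext
    intro y m
    exact (appLin_mk α M y m).symm⟩

end FullyFaithful

/-! ### Essential surjectivity and the equivalences. -/

variable (H A B : Type u) [Ring H] [HopfAlgebra ℂ H] [FiniteDimensional ℂ H]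
  [Ring A] [Algebra ℂ A] [FiniteDimensional ℂ A] [Ring B] [Algebra ℂ B]
  [LeftComoduleAlgebra H A] [LeftComoduleAlgebra H B]

/-- `Y ↦ Y ⊗_A -` is an equivalence onto a full subcategory of module functors as soon as the
evaluation morphisms `F A ⊗_A - ⟶ F` are invertible there. -/
theorem exists_equivalence_of_isIso_evalHom (P : ObjectProperty (OplaxModuleFunctor H A B))
    (hP : ∀ Y, P ((tensorFunctor H B A).obj Y)) (hle : P ≤ isModuleFunctor H A B)
    (hiso : ∀ (F : OplaxModuleFunctor H A B) [F.toFunctor.Additive] [F.toFunctor.Linear ℂ],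
      P F → ∀ M, IsIso (F.evalHom M)) :
    ∃ e : CovBimod H B A ≌ P.FullSubcategory,
      Nonempty (e.functor ⋙ P.ι ≅ tensorFunctor H B A) := by
  have hess : (P.lift (tensorFunctor H B A) hP).EssSurj := ⟨fun F => by
    have h1 : F.obj.toFunctor.Additive := (hle _ F.property).1
    have h2 : F.obj.toFunctor.Linear ℂ := (hle _ F.property).2.1
    have h3 : IsIso F.obj.eval := OplaxModuleFunctor.isIso_of_isIso_app _ (hiso F.obj F.property)
    exact ⟨F.obj.bimod, ⟨P.isoMk (asIso F.obj.eval)⟩⟩⟩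
  -- The lift inherits fullness and faithfulness from `tensorFunctor`; only essential surjectivity
  -- depends on `P`.
  have heq : (P.lift (tensorFunctor H B A) hP).IsEquivalence := { }
  exact ⟨(P.lift (tensorFunctor H B A) hP).asEquivalence, ⟨P.liftCompιIso _ hP⟩⟩

theorem exists_equivalence_rightExactModuleFunctor :
    ∃ e : CovBimod H B A ≌ RightExactModuleFunctor H A B,
      Nonempty (e.functor ⋙ (isRightExactModuleFunctor H A B).ι ≅ tensorFunctor H B A) :=
  exists_equivalence_of_isIso_evalHom H A B _ isRightExactModuleFunctor_tensorFunctor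
    (fun _ h => h.1) (fun F _ _ hF M => by
      have h : IsIso ((OplaxModuleFunctor.Hom.nat F.eval).app (regular A)) :=
        isIso_of_bijective _ F.bijective_evalHom_regular
      have h1 : (((tensorFunctor H B A).obj F.bimod).toFunctor).Additive :=
        inferInstanceAs (BalTensor.functor F.bimod).Additive
      exact isIso_app_of_isRightExact (OplaxModuleFunctor.Hom.nat F.eval)
        (BalTensor.isRightExact_functor F.bimod) hF.2 M)

/-- Right exactness of `F` is not needed: every module is a summand of a free one, so additivity
carries invertibility of `eval` from `A` to all modules. -/
theorem exists_equivalence_moduleFunctor [IsSemisimpleRing A] :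
    ∃ e : CovBimod H B A ≌ ModuleFunctor H A B,
      Nonempty (e.functor ⋙ (isModuleFunctor H A B).ι ≅ tensorFunctor H B A) :=
  exists_equivalence_of_isIso_evalHom H A B _
    (fun Y => (isRightExactModuleFunctor_tensorFunctor Y).1) le_rfl (fun F _ _ _ M => by
      have h : IsIso ((OplaxModuleFunctor.Hom.nat F.eval).app (regular A)) :=
        isIso_of_bijective _ F.bijective_evalHom_regular
      have h1 : (((tensorFunctor H B A).obj F.bimod).toFunctor).Additive :=
        inferInstanceAs (BalTensor.functor F.bimod).Additive
      obtain ⟨n, p, s, hs⟩ := exists_section_freeDesc M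
      exact isIso_app_of_section (OplaxModuleFunctor.Hom.nat F.eval) hs)

end Equivalence

end HopfBoundary

end

theorem mainTheorem3
    (H : Type u) [Ring H] [HopfAlgebra ℂ H] [FiniteDimensional ℂ H]
    (A : Type u) [Ring A] [Algebra ℂ A] [FiniteDimensional ℂ A] [LeftComoduleAlgebra H A]
    (B : Type u) [Ring B] [Algebra ℂ B] [FiniteDimensional ℂ B] [LeftComoduleAlgebra H B] :
    -- excitations of the `A`-boundary
    ((∃ e : CovBimod H A A ≌ RightExactModuleFunctor H A A,
        Nonempty (e.functor ⋙ (isRightExactModuleFunctor H A A).ι ≅ tensorFunctor H A A)) ∧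
      (IsSemisimpleRing A →
        ∃ e : CovBimod H A A ≌ ModuleFunctor H A A,
          Nonempty (e.functor ⋙ (isModuleFunctor H A A).ι ≅ tensorFunctor H A A))) ∧
    -- defects from the `A`-boundary to the `B`-boundary
    ((∃ e : CovBimod H B A ≌ RightExactModuleFunctor H A B,
        Nonempty (e.functor ⋙ (isRightExactModuleFunctor H A B).ι ≅ tensorFunctor H B A)) ∧
      (IsSemisimpleRing A →
        ∃ e : CovBimod H B A ≌ ModuleFunctor H A B,
          Nonempty (e.functor ⋙ (isModuleFunctor H A B).ι ≅ tensorFunctor H B A))) := by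
  -- Excitations are the defects from a boundary to itself, the case `B = A`.
  exact ⟨⟨exists_equivalence_rightExactModuleFunctor H A A,
      fun _ => exists_equivalence_moduleFunctor H A A⟩,
    exists_equivalence_rightExactModuleFunctor H A B,
    fun _ => exists_equivalence_moduleFunctor H A B⟩
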